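/- Equip $\mathbb{R}^d$ with the sup norm, let $B_1=[-1,1]^d$, and write $T_x(y)=y-x$ and $S_t(y)=e^ty$ for $x\in\mathbb{R}^d$, $t\in\mathbb{R}$; the push-forward of a measure $\mu$ through $f$ is $f\mu$. For a Radon measure $\mu$ on $\mathbb{R}^d$ with $\mu(B_1)>0$ put $\mu^*=\mu/\mu(B_1)$ and let $\mu^\square=\mu(B_1)^{-1}\mu|_{B_1}\in\mathcal{P}(B_1)$, where $\mathcal P(X)$ denotes the space of probability measures on $X$ (with the weak-* topology if $X$ is compact metric). Put $T_x^*\mu=(T_x\mu)^*$, $S_t^*\mu=(S_t\mu)^*$, $S_t^\square\mu=(S_t\mu)^\square$. Spaces of Radon measures carry the Borel $\sigma$-algebra of the weak-* topology. *Distributions.* Let $\mathcal{M}_0^*$ be the set of Radon measures $\mu$ on $\mathbb{R}^d$ with $\mu(B_1)=1$ and $0\in\operatorname{supp}\mu$; $S^*=(S_t^*)_{t\in\mathbb{R}}$ acts on it. A fractal distribution (FD) is a probability measure $P$ on $\mathcal{M}_0^*$ that is $S^*$-invariant and quasi-Palm, i.e. for every bounded open neighborhood $U$ of $0$ the measures $P$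 and $\int\langle\mu\rangle_U\,dP(\mu)$ have the same null sets, where $\langle\mu\rangle_U=\int_U\delta_{T_x^*\mu}\,d\mu(x)$. It is an ergodic fractal distribution (EFD) if moreover $P(A)\in\{0,1\}$ for every measurable $A$ with $P((S_t^*)^{-1}A\,\triangle\,A)=0$ for all $t\in\mathbb{R}$. The restricted version $P^\square$ of $P$ is its push-forward through $\mu\mapsto\mu^\square$. *Ergodic components.* Let $\mathcal{I}$ be the $\sigma$-algebra of $S^*$-invariant measurable subsets of $\mathcal{M}_0^*$. An ergodic decomposition of $P$ is an $\mathcal{I}$-measurable map $\mu\mapsto P_\mu\in\mathcal{P}(\mathcal{M}_0^*)$ such that $P=\int P_\mu\,dP(\mu)$, such that for $P$-a.e. $\mu$ the distribution $P_\mu$ is $S^*$-invariant and ergodic, and such that for every $A\in\mathcal{I}$ we have $P_\mu(A)=1$ for $P$-a.e. $\mu\in A$. The distribution $P_\mu$ is called the ergodic component of $P$ to which $\mu$ belongs. *Uniformly scaling measures.* For a Radon measure $\mu$, $x\in\operatorname{supp}\mu$ and $T>0$ let $$\langle\mu\rangle_{x,T}=\frac1T\int_0^T\delta_{S_t^\square(T_x\mu)}\,dt\in\mathcal{P}(\mathcal{P}(B_1)).$$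 $\mu$ is a uniformly scaling measure (USM) generating $Q\in\mathcal{P}(\mathcal{P}(B_1))$ if for $\mu$-a.e. $x$ we have $x\in\operatorname{supp}\mu$ and $\langle\mu\rangle_{x,T}\to Q$ in the weak-* topology as $T\to\infty$. **Theorem.** Let $P$ be a fractal distribution on $\mathbb{R}^d$. 1. $P$ has an ergodic decomposition, and for every ergodic decomposition $\mu\mapsto P_\mu$ of $P$, $P$-a.e. $\mu$ is a USM generating (the restricted version $P_\mu^\square$ of) the ergodic component $P_\mu$ to which $\mu$ belongs. 2. If $P$ is an ergodic fractal distribution, then $P$-a.e. $\mu$ is a USM generating (the restricted version $P^\square$ of) $P$. -/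

import Mathlib

open MeasureTheory Filter Topology Set

namespace FractalDist

noncomputable section

/-! ### Measures on `ℝ^d` and their normalizations

`Fin d → ℝ` carries the sup norm, so that the closed unit ball is `[-1,1]^d`. A Radon measure on
`ℝ^d` is a locally finite Borel measure. Spaces of measures carry Mathlib's sigma-algebra generated
by the evaluations `μ ↦ μ A`, `A` Borel; on Radon measures this is the Borel sigma-algebra of the
weak-* topology. -/

/-- The closed unit ball `B₁ = [-1,1]^d`. -/
def unitBall (d : ℕ) : Set (Fin d → ℝ) := Metric.closedBall 0 1

/-- `μ^* = μ / μ(B₁)`. -/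
def normStar {d : ℕ} (μ : Measure (Fin d → ℝ)) : Measure (Fin d → ℝ) := (μ (unitBall d))⁻¹ • μ

/-- `T_x μ`, the push-forward of `μ` through `T_x(y) = y - x`. -/
def transl {d : ℕ} (x : Fin d → ℝ) (μ : Measure (Fin d → ℝ)) : Measure (Fin d → ℝ) :=
  μ.map (fun y => y - x)

/-- `S_t μ`, the push-forward of `μ` through `S_t(y) = e^t y`. -/
def scale {d : ℕ} (t : ℝ) (μ : Measure (Fin d → ℝ)) : Measure (Fin d → ℝ) :=
  μ.map (fun y => Real.exp t • y)

/-- `T_x^* μ = (T_x μ)^*`. -/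
def translStar {d : ℕ} (x : Fin d → ℝ) (μ : Measure (Fin d → ℝ)) : Measure (Fin d → ℝ) :=
  normStar (transl x μ)

/-- `S_t^* μ = (S_t μ)^*`. -/
def scaleStar {d : ℕ} (t : ℝ) (μ : Measure (Fin d → ℝ)) : Measure (Fin d → ℝ) :=
  normStar (scale t μ)

theorem measurableSet_unitBall (d : ℕ) : MeasurableSet (unitBall d) :=
  Metric.isClosed_closedBall.measurableSet

/-- The origin as a point of `B₁`. -/
def ballZero (d : ℕ) : unitBall d := ⟨0, by simp [unitBall]⟩

open Classical in
/-- The restriction of `μ` to `B₁`, normalized to mass one. The operation is meant for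
`0 < μ(B₁) < ∞` only; otherwise the value is the point mass at the origin. -/
def boxMeasure {d : ℕ} (μ : Measure (Fin d → ℝ)) : Measure (unitBall d) :=
  if μ (unitBall d) ≠ 0 ∧ μ (unitBall d) ≠ ⊤ then (μ (unitBall d))⁻¹ • μ.comap Subtype.val
  else Measure.dirac (ballZero d)

theorem comap_val_apply {d : ℕ} (μ : Measure (Fin d → ℝ)) {s : Set (unitBall d)}
    (hs : MeasurableSet s) :
    μ.comap (Subtype.val : unitBall d → Fin d → ℝ) s = μ (Subtype.val '' s) :=
  Measure.comap_apply _ Subtype.val_injective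
    (fun _ h => (MeasurableEmbedding.subtype_coe (measurableSet_unitBall d)).measurableSet_image.2 h)
    _ hs

instance isProbabilityMeasure_boxMeasure {d : ℕ} (μ : Measure (Fin d → ℝ)) :
    IsProbabilityMeasure (boxMeasure μ) := by
  by_cases h : μ (unitBall d) ≠ 0 ∧ μ (unitBall d) ≠ ⊤
  · refine ⟨?_⟩
    rw [boxMeasure, if_pos h, Measure.smul_apply, comap_val_apply μ MeasurableSet.univ, image_univ,
      Subtype.range_coe, smul_eq_mul]
    exact ENNReal.inv_mul_cancel h.1 h.2
  · rw [boxMeasure, if_neg h]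
    infer_instance

/-- `μ^□`, as an element of the space of probability measures on `B₁`. -/
def box {d : ℕ} (μ : Measure (Fin d → ℝ)) : ProbabilityMeasure (unitBall d) :=
  ⟨boxMeasure μ, inferInstance⟩

theorem measurable_box (d : ℕ) :
    Measurable (box : Measure (Fin d → ℝ) → ProbabilityMeasure (unitBall d)) := by
  have hev : Measurable fun μ : Measure (Fin d → ℝ) => μ (unitBall d) :=
    Measure.measurable_coe (measurableSet_unitBall d)
  have hset : MeasurableSet
      {μ : Measure (Fin d → ℝ) | μ (unitBall d) ≠ 0 ∧ μ (unitBall d) ≠ ⊤} :=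
    (hev (measurableSet_singleton 0).compl).inter (hev (measurableSet_singleton ⊤).compl)
  refine Measurable.subtype_mk (f := boxMeasure) ?_
  refine Measurable.ite hset ?_ measurable_const
  refine Measure.measurable_of_measurable_coe _ fun s hs => ?_
  have hs' : MeasurableSet (Subtype.val '' s : Set (Fin d → ℝ)) :=
    (MeasurableEmbedding.subtype_coe (measurableSet_unitBall d)).measurableSet_image.2 hs
  simp_rw [Measure.smul_apply, comap_val_apply _ hs, smul_eq_mul]
  exact hev.inv.mul (Measure.measurable_coe hs')

/-! ### Sceneries and generated distributions -/

instance compactSpace_unitBall (d : ℕ) : CompactSpace (unitBall d) :=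
  isCompact_iff_compactSpace.1 (isCompact_closedBall 0 1)

/-- Weakly open sets of probability measures on `B₁` are measurable, so that weak convergence of
distributions on `𝓟(B₁)` makes sense. -/
instance opensMeasurableSpace_probabilityMeasure (d : ℕ) :
    OpensMeasurableSpace (ProbabilityMeasure (unitBall d)) := by
  let g : (BoundedContinuousFunction (unitBall d) NNReal) → ProbabilityMeasure (unitBall d) → NNReal :=
    fun f μ => μ.toFiniteMeasure.testAgainstNN f
  let S : Set (Set (ProbabilityMeasure (unitBall d))) := {A | ∃ f V, IsOpen V ∧ A = g f ⁻¹' V}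
  let := TopologicalSpace.pseudoMetrizableSpacePseudoMetric (ProbabilityMeasure (unitBall d))
  have hS : (inferInstance : TopologicalSpace (ProbabilityMeasure (unitBall d))) =
      TopologicalSpace.generateFrom S := by
    apply le_antisymm
    · refine le_generateFrom ?_
      rintro A ⟨f, V, hV, rfl⟩
      exact hV.preimage (ProbabilityMeasure.continuous_testAgainstNN_eval f)
    · have h1 : @Continuous _ _ (TopologicalSpace.generateFrom S) _
          (fun (μ : ProbabilityMeasure (unitBall d)) f => g f μ) := by
        refine @continuous_pi _ _ _ (TopologicalSpace.generateFrom S) _ _ fun f => ?_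
        refine (@continuous_def _ _ (TopologicalSpace.generateFrom S) _ _).2 fun V hV => ?_
        exact TopologicalSpace.isOpen_generateFrom_of_mem ⟨f, V, hV, rfl⟩
      have h2 := continuous_iff_le_induced.1 h1
      refine h2.trans (le_of_eq ?_)
      have h3 : Topology.IsInducing (fun (μ : ProbabilityMeasure (unitBall d)) f => g f μ) := by
        have h4 : Topology.IsInducing
            (fun (φ : WeakDual NNReal (BoundedContinuousFunction (unitBall d) NNReal)) f => φ f) :=
          ⟨rfl⟩
        have h5 : Topology.IsInducing (FiniteMeasure.toWeakDualBCNN (Ω := unitBall d)) := ⟨rfl⟩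
        exact h4.comp (h5.comp
          (ProbabilityMeasure.toFiniteMeasure_isEmbedding (unitBall d)).isInducing)
      exact h3.eq_induced.symm
  refine ⟨?_⟩
  rw [borel_eq_generateFrom_of_subbasis hS]
  refine MeasurableSpace.generateFrom_le ?_
  rintro A ⟨f, V, hV, rfl⟩
  have hg : Measurable (g f) := by
    change Measurable fun μ : ProbabilityMeasure (unitBall d) =>
      (∫⁻ ω, f ω ∂(μ : Measure (unitBall d))).toNNReal
    exact ((Measure.measurable_lintegral (by fun_prop)).comp
      measurable_subtype_coe).ennreal_toNNReal
  exact hg hV.measurableSet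

/-- The scenery `μ_{x,t}^□ = S_t^□ (T_x μ)` of `μ` at `x`. -/
def scenery {d : ℕ} (μ : Measure (Fin d → ℝ)) (x : Fin d → ℝ) (t : ℝ) :
    ProbabilityMeasure (unitBall d) :=
  box (scale t (transl x μ))

theorem measurable_scenery {d : ℕ} (μ : Measure (Fin d → ℝ)) [IsLocallyFiniteMeasure μ]
    (x : Fin d → ℝ) : Measurable (scenery μ x) := by
  refine (measurable_box d).comp (Measure.measurable_of_measurable_coe _ fun s hs => ?_)
  have hmap : ∀ t : ℝ, scale t (transl x μ) s = μ (Prod.mk t ⁻¹'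
      {p : ℝ × (Fin d → ℝ) | Real.exp p.1 • (p.2 - x) ∈ s}) := by
    intro t
    rw [scale, transl, Measure.map_map (by fun_prop) (by fun_prop),
      Measure.map_apply (by fun_prop) hs]
    rfl
  simp_rw [hmap]
  refine measurable_measure_prodMk_left ?_
  exact (by fun_prop : Measurable fun p : ℝ × (Fin d → ℝ) => Real.exp p.1 • (p.2 - x)) hs

open Classical in
/-- The scenery distribution `⟨μ⟩_{x,T} = (1/T) ∫₀ᵀ δ_{μ_{x,t}^□} dt`, that is, the push-forward of
the uniform probability measure on `[0,T]` through the scenery (a point mass for `T ≤ 0`, which is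
irrelevant). -/
def sceneryMeasure {d : ℕ} (μ : Measure (Fin d → ℝ)) (x : Fin d → ℝ) (T : ℝ) :
    Measure (ProbabilityMeasure (unitBall d)) :=
  if 0 < T then (ENNReal.ofReal T)⁻¹ • (volume.restrict (Icc 0 T)).map (scenery μ x)
  else Measure.dirac (scenery μ x 0)

instance isProbabilityMeasure_sceneryMeasure {d : ℕ} (μ : Measure (Fin d → ℝ))
    [IsLocallyFiniteMeasure μ] (x : Fin d → ℝ) (T : ℝ) :
    IsProbabilityMeasure (sceneryMeasure μ x T) := by
  by_cases hT : 0 < T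
  · refine ⟨?_⟩
    rw [sceneryMeasure, if_pos hT, Measure.smul_apply,
      Measure.map_apply (measurable_scenery μ x) MeasurableSet.univ, preimage_univ,
      Measure.restrict_apply_univ, Real.volume_Icc, sub_zero, smul_eq_mul]
    exact ENNReal.inv_mul_cancel (by simpa using hT) ENNReal.ofReal_ne_top
  · rw [sceneryMeasure, if_neg hT]
    infer_instance

/-- `⟨μ⟩_{x,T}`, as an element of the space of probability measures on `𝓟(B₁)`. -/
def sceneryDist {d : ℕ} (μ : Measure (Fin d → ℝ)) [IsLocallyFiniteMeasure μ] (x : Fin d → ℝ)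
    (T : ℝ) : ProbabilityMeasure (ProbabilityMeasure (unitBall d)) :=
  ⟨sceneryMeasure μ x T, inferInstance⟩

/-- `μ` generates `Q` at the point `x` of its support: `⟨μ⟩_{x,T} → Q` weakly as `T → ∞`. -/
def GeneratesAt {d : ℕ} (μ : Measure (Fin d → ℝ)) [IsLocallyFiniteMeasure μ] (x : Fin d → ℝ)
    (Q : ProbabilityMeasure (ProbabilityMeasure (unitBall d))) : Prop :=
  x ∈ μ.support ∧ Tendsto (fun T : ℝ => sceneryDist μ x T) atTop (𝓝 Q)

/-- `μ` is a uniformly scaling measure and generates `Q`: it generates the one distribution `Q` at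
`μ`-almost every point. -/
def IsUSMGenerating {d : ℕ} (μ : Measure (Fin d → ℝ)) [IsLocallyFiniteMeasure μ]
    (Q : ProbabilityMeasure (ProbabilityMeasure (unitBall d))) : Prop :=
  ∀ᵐ x ∂μ, GeneratesAt μ x Q

/-! ### The scaling flow -/

/-- The set `{μ ∈ 𝓜^* : 0 ∈ supp μ}` on which the operators `S_t^*`, `t ∈ ℝ`, act. -/
abbrev Phase (d : ℕ) : Type :=
  {μ : Measure (Fin d → ℝ) // IsLocallyFiniteMeasure μ ∧ μ (unitBall d) = 1 ∧ 0 ∈ μ.support}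

instance isLocallyFiniteMeasure_phase {d : ℕ} (μ : Phase d) : IsLocallyFiniteMeasure μ.1 := μ.2.1

theorem scale_apply {d : ℕ} (t : ℝ) (μ : Measure (Fin d → ℝ)) {s : Set (Fin d → ℝ)}
    (hs : MeasurableSet s) : scale t μ s = μ ((fun y => Real.exp t • y) ⁻¹' s) :=
  Measure.map_apply (by fun_prop) hs

theorem scaleStar_mem {d : ℕ} (t : ℝ) (μ : Phase d) :
    IsLocallyFiniteMeasure (scaleStar t μ.1) ∧ scaleStar t μ.1 (unitBall d) = 1 ∧
      0 ∈ (scaleStar t μ.1).support := by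
  have hcont : Continuous fun y : Fin d → ℝ => Real.exp t • y := by fun_prop
  have hlf : ∀ K : Set (Fin d → ℝ), IsCompact K → scale t μ.1 K ≠ ⊤ := by
    intro K hK
    rw [scale_apply t _ hK.isClosed.measurableSet]
    have : IsCompact ((fun y : Fin d → ℝ => Real.exp t • y) ⁻¹' K) :=
      (Homeomorph.smulOfNeZero (Real.exp t) (Real.exp_pos t).ne').isCompact_preimage.2 hK
    exact this.measure_lt_top.ne
  have hpos : ∀ V ∈ 𝓝 (0 : Fin d → ℝ), scale t μ.1 V ≠ 0 := by
    intro V hV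
    obtain ⟨W, hWV, hW, h0⟩ := mem_nhds_iff.1 hV
    have h1 : (fun y : Fin d → ℝ => Real.exp t • y) ⁻¹' W ∈ 𝓝 (0 : Fin d → ℝ) :=
      (hW.preimage hcont).mem_nhds (by simpa using h0)
    have h2 := (Measure.mem_support_iff_forall _).1 μ.2.2.2 _ h1
    rw [← scale_apply t _ hW.measurableSet] at h2
    exact (h2.trans_le (measure_mono hWV)).ne'
  have hB0 : scale t μ.1 (unitBall d) ≠ 0 := hpos _ (Metric.closedBall_mem_nhds _ one_pos)
  have hBt : scale t μ.1 (unitBall d) ≠ ⊤ := hlf _ (isCompact_closedBall 0 1)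
  refine ⟨⟨fun x => ⟨Metric.closedBall x 1, Metric.closedBall_mem_nhds _ one_pos, ?_⟩⟩, ?_, ?_⟩
  · rw [scaleStar, normStar, Measure.smul_apply, smul_eq_mul]
    exact ENNReal.mul_lt_top (ENNReal.inv_lt_top.2 (pos_iff_ne_zero.2 hB0))
      (lt_top_iff_ne_top.2 (hlf _ (isCompact_closedBall x 1)))
  · rw [scaleStar, normStar, Measure.smul_apply, smul_eq_mul]
    exact ENNReal.inv_mul_cancel hB0 hBt
  · rw [Measure.mem_support_iff_forall]
    intro V hV
    rw [scaleStar, normStar, Measure.smul_apply, smul_eq_mul]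
    exact ENNReal.mul_pos (ENNReal.inv_ne_zero.2 hBt) (hpos V hV)

/-- The action `t ↦ S_t^*` of `ℝ`. -/
def flow {d : ℕ} (t : ℝ) (μ : Phase d) : Phase d := ⟨scaleStar t μ.1, scaleStar_mem t μ⟩

/-- The sigma-algebra of `S^*`-invariant measurable sets. -/
abbrev invariantSets (d : ℕ) : MeasurableSpace (Phase d) :=
  ⨅ t : ℝ, MeasurableSpace.invariants (flow (d := d) t)

/-! ### Fractal distributions -/

/-- `P` is `S^*`-invariant. -/
def IsScaleInvariant {d : ℕ} (P : ProbabilityMeasure (Phase d)) : Prop :=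
  ∀ t : ℝ, MeasurePreserving (flow t) (P : Measure (Phase d)) (P : Measure (Phase d))

/-- `P` is ergodic for `S^*`: the almost invariant sets have probability `0` or `1`. -/
def IsErgodicDist {d : ℕ} (P : ProbabilityMeasure (Phase d)) : Prop :=
  ∀ A : Set (Phase d), MeasurableSet A →
    (∀ t : ℝ, (P : Measure (Phase d)) (symmDiff (flow t ⁻¹' A) A) = 0) →
      (P : Measure (Phase d)) A = 0 ∨ (P : Measure (Phase d)) A = 1

/-- The `U`-diffusion `⟨μ⟩_U = ∫_U δ_{T_x^* μ} dμ(x)`. -/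
def diffusion {d : ℕ} (U : Set (Fin d → ℝ)) (μ : Measure (Fin d → ℝ)) :
    Measure (Measure (Fin d → ℝ)) :=
  (μ.restrict U).map (fun x => translStar x μ)

/-- `P` is quasi-Palm: `P` and `∫ ⟨μ⟩_U dP(μ)` have the same null sets, for every bounded open
neighborhood `U` of the origin. -/
def IsQuasiPalm {d : ℕ} (P : ProbabilityMeasure (Phase d)) : Prop :=
  ∀ U : Set (Fin d → ℝ), IsOpen U → Bornology.IsBounded U → 0 ∈ U →
    (P : Measure (Phase d)).map Subtype.val ≪
        (P : Measure (Phase d)).bind (fun μ => diffusion U μ.1) ∧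
      (P : Measure (Phase d)).bind (fun μ => diffusion U μ.1) ≪
        (P : Measure (Phase d)).map Subtype.val

/-- Fractal distributions (FDs). -/
def IsFractalDistribution {d : ℕ} (P : ProbabilityMeasure (Phase d)) : Prop :=
  IsScaleInvariant P ∧ IsQuasiPalm P

/-- The restricted version `P^□`, the push-forward of `P` through `μ ↦ μ^□`. -/
def restricted {d : ℕ} (P : ProbabilityMeasure (Phase d)) :
    ProbabilityMeasure (ProbabilityMeasure (unitBall d)) :=
  P.map (f := fun μ => box μ.1) ((measurable_box d).comp measurable_subtype_coe).aemeasurable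

/-- `μ ↦ κ μ` is an ergodic decomposition of `P` for `S^*`; `κ μ` is then the ergodic component of
`P` to which `μ` belongs. The last field says that `κ μ` is carried by the atom, modulo null sets, of
the sigma-algebra of invariant sets that contains `μ`: almost every point of an invariant set has a
component carried by that set. (That sigma-algebra is not countably generated, and its pointwise
atoms are single orbits.) -/
structure IsErgodicDecomposition {d : ℕ} (P : ProbabilityMeasure (Phase d))
    (κ : Phase d → ProbabilityMeasure (Phase d)) : Prop where
  measurable : Measurable[invariantSets d] κ
  barycenter : (P : Measure (Phase d)).bind (fun μ => (κ μ : Measure (Phase d))) = P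
  ae_invariant : ∀ᵐ μ ∂(P : Measure (Phase d)), IsScaleInvariant (κ μ)
  ae_ergodic : ∀ᵐ μ ∂(P : Measure (Phase d)), IsErgodicDist (κ μ)
  ae_carried : ∀ A : Set (Phase d), MeasurableSet[invariantSets d] A →
    ∀ᵐ μ ∂(P : Measure (Phase d)), μ ∈ A → (κ μ : Measure (Phase d)) A = 1

end

end FractalDist

/-!
The scenery of `μ` at the origin is the orbit of `μ` under the scaling flow, seen through
`μ ↦ μ^□`. By the pointwise ergodic theorem for flows, averages of a continuous `g` along it
therefore converge, for `P`-almost every `μ`, to the integral of `g` against the component of `μ`: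
ergodic components are the conditional measures of `P` on the invariant sigma-algebra.

The quasi-Palm property carries convergence from the origin to `μ`-almost every point `x`, and what
remains is that the limit at `x` is the one at the origin. Let `F(x)` be the upper limit of the
averages of `g` along the scenery of `μ` at `x`. Almost every `x` is a Lebesgue point of `F`, so by
the quasi-Palm property the mean oscillation of `F` over the ball of radius `e^{-n}` about the
origin almost surely tends to `0`. Scaling turns it into the mean oscillation over `B₁` for
`S_n^* μ`, and `P` is invariant, so the mean oscillation over `B₁` vanishes almost surely. Applied
to `S_{-n}^* μ` this shows that `F` is almost everywhere constant on the ball of radius `e^n`, for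
all `n`.
-/

namespace FractalDist

open ProbabilityTheory

noncomputable section

/-! ### Cesàro averages -/

section Cesaro

/-- The average of `u` over `[0, T]`. -/
def cesaro (u : ℝ → ℝ) (T : ℝ) : ℝ := ⨍ t in (0 : ℝ)..T, u t

/-- The upper limit of the averages of `u`. Only integer horizons enter, which makes it a countable
upper limit, hence measurable in parameters. -/
def cesaroLimsup (u : ℝ → ℝ) : ℝ := limsup (fun n : ℕ => cesaro u n) atTop

theorem cesaro_eq_inv_mul (u : ℝ → ℝ) (T : ℝ) : cesaro u T = T⁻¹ * ∫ t in 0..T, u t := by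
  rw [cesaro, interval_average_eq, sub_zero, smul_eq_mul]

theorem cesaro_neg (u : ℝ → ℝ) (T : ℝ) : cesaro (-u) T = -cesaro u T := by
  simp [cesaro_eq_inv_mul]

theorem limsup_eq_of_tendsto_sub {ι : Type*} {l : Filter ι} [l.NeBot] {a b : ι → ℝ}
    (hb : IsBoundedUnder (· ≤ ·) l b) (hb' : IsBoundedUnder (· ≥ ·) l b)
    (h : Tendsto (a - b) l (𝓝 0)) : limsup a l = limsup b l := by
  have h_le := limsup_add_le h.isBoundedUnder_ge h.isBoundedUnder_le hb'.isCoboundedUnder_le hb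
  have h_ge := le_limsup_add hb hb'.isCoboundedUnder_le h.isBoundedUnder_le h.isBoundedUnder_ge
  rw [h.limsup_eq, sub_add_cancel, zero_add] at h_le
  rw [h.liminf_eq, add_sub_cancel, add_zero] at h_ge
  exact le_antisymm h_le h_ge

variable {u : ℝ → ℝ} {C : ℝ}

theorem intervalIntegrable_of_abs_le (hu : Measurable u) (hC : ∀ t, |u t| ≤ C) (a b : ℝ) :
    IntervalIntegrable u volume a b :=
  (intervalIntegrable_const (c := C)).mono_fun hu.aestronglyMeasurable
    (Eventually.of_forall fun t => (hC t).trans (le_abs_self C))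

theorem abs_integral_le_of_abs_le (hC : ∀ t, |u t| ≤ C) (a b : ℝ) :
    |∫ t in a..b, u t| ≤ C * |b - a| := by
  rw [← Real.norm_eq_abs]
  exact intervalIntegral.norm_integral_le_of_norm_le_const fun t _ => hC t

theorem abs_cesaro_le (hC : ∀ t, |u t| ≤ C) (T : ℝ) : |cesaro u T| ≤ C := by
  have h0 : 0 ≤ C := (abs_nonneg _).trans (hC 0)
  have h := abs_integral_le_of_abs_le hC 0 T
  rw [sub_zero] at h
  rw [cesaro_eq_inv_mul, abs_mul, abs_inv]
  exact inv_mul_le_of_le_mul₀ (abs_nonneg T) h0 (by rwa [mul_comm])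

theorem isBoundedUnder_cesaro (hC : ∀ t, |u t| ≤ C) :
    IsBoundedUnder (· ≤ ·) atTop (fun n : ℕ => cesaro u n) ∧
      IsBoundedUnder (· ≥ ·) atTop (fun n : ℕ => cesaro u n) :=
  isBoundedUnder_le_abs.1 (isBoundedUnder_of ⟨C, fun n => abs_cesaro_le hC n⟩)

theorem abs_cesaroLimsup_le (hC : ∀ t, |u t| ≤ C) : |cesaroLimsup u| ≤ C := by
  obtain ⟨h_le, h_ge⟩ := isBoundedUnder_cesaro hC
  have h n := abs_le.1 (abs_cesaro_le hC n)
  exact abs_le.2 ⟨le_limsup_of_frequently_le (Frequently.of_forall fun n : ℕ => (h n).1) h_le,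
    limsup_le_of_le h_ge.isCoboundedUnder_le (Eventually.of_forall fun n : ℕ => (h n).2)⟩

theorem tendsto_cesaro_of_cesaroLimsup_le (hC : ∀ t, |u t| ≤ C) {L : ℝ} (h : cesaroLimsup u ≤ L)
    (h_neg : cesaroLimsup (-u) ≤ -L) : Tendsto (fun n : ℕ => cesaro u n) atTop (𝓝 L) := by
  have hb_neg := (isBoundedUnder_cesaro (u := -u) (by simpa using hC)).1
  refine tendsto_order.2 ⟨fun a ha => ?_, fun a ha =>
    eventually_lt_of_limsup_lt (h.trans_lt ha) (isBoundedUnder_cesaro hC).1⟩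
  filter_upwards [eventually_lt_of_limsup_lt (h_neg.trans_lt (neg_lt_neg ha)) hb_neg] with n hn
  rwa [cesaro_neg, neg_lt_neg_iff] at hn

theorem abs_integral_shift_sub_le (hu : Measurable u) (hC : ∀ t, |u t| ≤ C) (s T : ℝ) :
    |(∫ t in 0..T, u (t + s)) - ∫ t in 0..T, u t| ≤ 2 * C * |s| := by
  have hi := intervalIntegrable_of_abs_le hu hC
  have h_ends : (∫ t in 0..T, u (t + s)) - ∫ t in 0..T, u t =
      (∫ t in T..T + s, u t) - ∫ t in 0..s, u t := by
    rw [intervalIntegral.integral_comp_add_right, zero_add,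
      ← intervalIntegral.integral_interval_sub_interval_comm (hi _ _) (hi _ _) (hi _ _),
      intervalIntegral.integral_symm s 0, intervalIntegral.integral_symm T]
    ring
  calc _ ≤ |∫ t in T..T + s, u t| + |∫ t in 0..s, u t| := h_ends ▸ abs_sub _ _
    _ ≤ C * |T + s - T| + C * |s - 0| :=
      add_le_add (abs_integral_le_of_abs_le hC _ _) (abs_integral_le_of_abs_le hC _ _)
    _ = 2 * C * |s| := by rw [add_sub_cancel_left, sub_zero]; ring

theorem tendsto_cesaro_shift_sub (hu : Measurable u) (hC : ∀ t, |u t| ≤ C) (s : ℝ) :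
    Tendsto (fun T => cesaro (fun t => u (t + s)) T - cesaro u T) atTop (𝓝 0) := by
  refine squeeze_zero_norm' (a := fun T => T⁻¹ * (2 * C * |s|)) ?_
    (by simpa using tendsto_inv_atTop_zero.mul_const (2 * C * |s|))
  filter_upwards [eventually_ge_atTop 0] with T hT
  rw [cesaro_eq_inv_mul, cesaro_eq_inv_mul, ← mul_sub, norm_mul, norm_inv, Real.norm_of_nonneg hT]
  exact mul_le_mul_of_nonneg_left (abs_integral_shift_sub_le hu hC s T) (inv_nonneg.2 hT)

theorem cesaroLimsup_shift (hu : Measurable u) (hC : ∀ t, |u t| ≤ C) (s : ℝ) :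
    cesaroLimsup (fun t => u (t + s)) = cesaroLimsup u :=
  limsup_eq_of_tendsto_sub (isBoundedUnder_cesaro hC).1 (isBoundedUnder_cesaro hC).2
    ((tendsto_cesaro_shift_sub hu hC s).comp tendsto_natCast_atTop_atTop)

theorem tendsto_cesaro_of_tendsto_nat (hu : Measurable u) (hC : ∀ t, |u t| ≤ C) {L : ℝ}
    (h : Tendsto (fun n : ℕ => cesaro u n) atTop (𝓝 L)) : Tendsto (cesaro u) atTop (𝓝 L) := by
  have hi := intervalIntegrable_of_abs_le hu hC
  have h_floor : Tendsto (fun T : ℝ => (⌊T⌋₊ : ℝ) / T * cesaro u (⌊T⌋₊ : ℕ)) atTop (𝓝 L) := by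
    simpa using tendsto_nat_floor_div_atTop.mul (h.comp tendsto_nat_floor_atTop)
  have h_diff : Tendsto (fun T : ℝ => cesaro u T - (⌊T⌋₊ : ℝ) / T * cesaro u (⌊T⌋₊ : ℕ)) atTop
      (𝓝 0) := by
    refine squeeze_zero_norm' (a := fun T : ℝ => T⁻¹ * C) ?_
      (by simpa using tendsto_inv_atTop_zero.mul_const C)
    filter_upwards [eventually_ge_atTop 1] with T hT
    have hT0 : 0 ≤ T := zero_le_one.trans hT
    have h_floor_ne : (⌊T⌋₊ : ℝ) ≠ 0 := by exact_mod_cast (Nat.floor_pos.2 hT).ne'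
    have h_tail : cesaro u T - (⌊T⌋₊ : ℝ) / T * cesaro u (⌊T⌋₊ : ℕ) =
        T⁻¹ * ∫ t in (⌊T⌋₊ : ℝ)..T, u t := by
      rw [cesaro_eq_inv_mul, cesaro_eq_inv_mul,
        ← intervalIntegral.integral_add_adjacent_intervals (hi 0 ⌊T⌋₊) (hi ⌊T⌋₊ T)]
      field_simp
      ring
    have h_len : |T - ⌊T⌋₊| ≤ 1 := by
      rw [abs_le]
      constructor <;> linarith [Nat.floor_le hT0, Nat.lt_floor_add_one T]
    rw [h_tail, norm_mul, norm_inv, Real.norm_of_nonneg hT0]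
    exact mul_le_mul_of_nonneg_left ((abs_integral_le_of_abs_le hC _ _).trans
      (mul_le_of_le_one_right ((abs_nonneg _).trans (hC 0)) h_len)) (inv_nonneg.2 hT0)
  simpa using h_diff.add h_floor

end Cesaro

section Measurability

variable {A : Type*} [MeasurableSpace A] {f : A → ℝ → ℝ}

theorem measurable_intervalIntegral (hf : Measurable (Function.uncurry f)) (a b : ℝ) :
    Measurable fun x => ∫ t in a..b, f x t :=
  hf.stronglyMeasurable.integral_prod_right.measurable.sub
    hf.stronglyMeasurable.integral_prod_right.measurable

theorem measurable_cesaro (hf : Measurable (Function.uncurry f)) (T : ℝ) :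
    Measurable fun x => cesaro (f x) T := by
  simpa only [cesaro_eq_inv_mul] using (measurable_intervalIntegral hf 0 T).const_mul T⁻¹

theorem measurable_cesaroLimsup (hf : Measurable (Function.uncurry f)) :
    Measurable fun x => cesaroLimsup (f x) :=
  Measurable.limsup fun n => measurable_cesaro hf n

end Measurability

/-! ### The maximal ergodic inequality -/

section Maximal

variable {X : Type*}

/-- The maximal function of the maximal ergodic inequality: the largest of the Birkhoff sums of `f`
of length at most `N`, the empty one included. -/
def birkhoffMax (T : X → X) (f : X → ℝ) : ℕ → X → ℝ
  | 0 => fun _ => 0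
  | N + 1 => fun x => max 0 (f x + birkhoffMax T f N (T x))

variable {T : X → X} {f : X → ℝ}

theorem birkhoffMax_nonneg (N : ℕ) (x : X) : 0 ≤ birkhoffMax T f N x := by
  cases N with
  | zero => exact le_rfl
  | succ N => exact le_max_left _ _

theorem monotone_birkhoffMax : Monotone (birkhoffMax T f) := by
  refine monotone_nat_of_le_succ fun N => ?_
  induction N with
  | zero => exact birkhoffMax_nonneg 1
  | succ N ih => exact fun x => max_le_max le_rfl (by gcongr; exact ih (T x))

theorem birkhoffSum_le_birkhoffMax (N : ℕ) (x : X) : birkhoffSum T f N x ≤ birkhoffMax T f N x := by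
  induction N generalizing x with
  | zero => simp [birkhoffMax]
  | succ N ih =>
    rw [birkhoffSum_succ']
    exact le_max_of_le_right (by gcongr; exact ih (T x))

theorem birkhoffMax_le_add_comp {N : ℕ} {x : X} (hx : 0 < birkhoffMax T f N x) :
    birkhoffMax T f N x ≤ f x + birkhoffMax T f N (T x) := by
  cases N with
  | zero => exact absurd hx (lt_irrefl _)
  | succ N =>
    have h_pos : 0 < f x + birkhoffMax T f N (T x) :=
      (lt_max_iff.1 hx).resolve_left (lt_irrefl _)
    calc birkhoffMax T f (N + 1) x = f x + birkhoffMax T f N (T x) := max_eq_right h_pos.le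
      _ ≤ _ := by gcongr; exact monotone_birkhoffMax N.le_succ (T x)

variable [MeasurableSpace X]

theorem measurable_birkhoffMax (hT : Measurable T) (hf : Measurable f) (N : ℕ) :
    Measurable (birkhoffMax T f N) := by
  induction N with
  | zero => exact measurable_const
  | succ N ih => exact measurable_const.max (hf.add (ih.comp hT))

variable {P : Measure X}

theorem integrable_birkhoffMax (hT : MeasurePreserving T P P) (hf : Integrable f P) (N : ℕ) :
    Integrable (birkhoffMax T f N) P := by
  induction N with
  | zero => exact integrable_zero _ _ _
  | succ N ih => exact (integrable_zero _ _ _).sup (hf.add (hT.integrable_comp_of_integrable ih))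

theorem integral_comp_of_measurePreserving (hT : MeasurePreserving T P P)
    (hf : AEStronglyMeasurable f P) : ∫ x, f (T x) ∂P = ∫ x, f x ∂P := by
  rw [← integral_map hT.aemeasurable (hT.map_eq.symm ▸ hf), hT.map_eq]

theorem setIntegral_birkhoffMax_pos_nonneg (hT : MeasurePreserving T P P) (hfm : Measurable f)
    (hf : Integrable f P) (N : ℕ) : 0 ≤ ∫ x in {x | 0 < birkhoffMax T f N x}, f x ∂P := by
  have hM := integrable_birkhoffMax hT hf N
  have hMT : Integrable (fun x => birkhoffMax T f N (T x)) P := hT.integrable_comp_of_integrable hM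
  have hA : MeasurableSet {x | 0 < birkhoffMax T f N x} :=
    measurableSet_lt measurable_const (measurable_birkhoffMax hT.measurable hfm N)
  have h_zero : ∫ x, (birkhoffMax T f N x - birkhoffMax T f N (T x)) ∂P = 0 := by
    rw [integral_sub hM hMT, integral_comp_of_measurePreserving hT hM.aestronglyMeasurable,
      sub_self]
  rw [← integral_indicator hA]
  refine h_zero.symm.le.trans
    (integral_mono (hM.sub hMT) (hf.indicator hA) fun x => sub_le_iff_le_add.2 ?_)
  by_cases hx : 0 < birkhoffMax T f N x
  · simpa [hx] using birkhoffMax_le_add_comp hx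
  · simpa [hx] using (not_lt.1 hx).trans (birkhoffMax_nonneg N (T x))

theorem integral_nonneg_of_ae_exists_birkhoffSum_pos (hT : MeasurePreserving T P P)
    (hfm : Measurable f) (hf : Integrable f P) (h : ∀ᵐ x ∂P, ∃ n, 0 < birkhoffSum T f n x) :
    0 ≤ ∫ x, f x ∂P := by
  have h_lim := tendsto_setIntegral_of_monotone (s := fun N => {x | 0 < birkhoffMax T f N x})
    (fun N => measurableSet_lt measurable_const (measurable_birkhoffMax hT.measurable hfm N))
    (fun M N hMN x (hx : 0 < _) => hx.trans_le (monotone_birkhoffMax hMN x)) hf.integrableOn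
  have h_univ : (⋃ N, {x | 0 < birkhoffMax T f N x}) =ᵐ[P] univ := by
    rw [eventuallyEq_univ]
    filter_upwards [h] with x ⟨n, hn⟩
    exact mem_iUnion.2 ⟨n, hn.trans_le (birkhoffSum_le_birkhoffMax n x)⟩
  rw [setIntegral_congr_set h_univ, setIntegral_univ] at h_lim
  exact ge_of_tendsto' h_lim (setIntegral_birkhoffMax_pos_nonneg hT hfm hf)

end Maximal

/-! ### The pointwise ergodic theorem for flows -/

section Flow

variable {X : Type*} [MeasurableSpace X]

/-- A jointly measurable action of `ℝ`. -/
structure IsMeasurableFlow (S : ℝ → X → X) : Prop where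
  measurable_uncurry : Measurable (Function.uncurry S)
  map_add : ∀ s t x, S (s + t) x = S s (S t x)
  map_zero : ∀ x, S 0 x = x

/-- The sigma-algebra of invariant measurable sets. -/
abbrev flowInvariants (S : ℝ → X → X) : MeasurableSpace X :=
  ⨅ t : ℝ, MeasurableSpace.invariants (S t)

variable {S : ℝ → X → X}

theorem measurableSet_flowInvariants {A : Set X} :
    MeasurableSet[flowInvariants S] A ↔ MeasurableSet A ∧ ∀ t, S t ⁻¹' A = A := by
  simp only [MeasurableSpace.measurableSet_iInf, MeasurableSpace.measurableSet_invariants,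
    forall_and, forall_const]

theorem flowInvariants_le (S : ℝ → X → X) : flowInvariants S ≤ ‹MeasurableSpace X› :=
  fun _ h => (measurableSet_flowInvariants.1 h).1

theorem measurable_flowInvariants {β : Type*} [MeasurableSpace β] {c : X → β} (hc : Measurable c)
    (h : ∀ t x, c (S t x) = c x) : Measurable[flowInvariants S] c := fun B hB =>
  measurableSet_flowInvariants.2 ⟨hc hB, fun t => by ext x; simp only [mem_preimage, h]⟩

theorem measurePreserving_restrict_of_invariant {P : Measure X}
    (hP : ∀ t, MeasurePreserving (S t) P P) {E : Set X} (hE : MeasurableSet[flowInvariants S] E)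
    (t : ℝ) : MeasurePreserving (S t) (P.restrict E) (P.restrict E) := by
  obtain ⟨hEm, hE_inv⟩ := measurableSet_flowInvariants.1 hE
  simpa only [hE_inv t] using (hP t).restrict_preimage hEm

namespace IsMeasurableFlow

variable (hS : IsMeasurableFlow S)

include hS

theorem measurable (t : ℝ) : Measurable (S t) :=
  hS.measurable_uncurry.comp measurable_prodMk_left

theorem measurable_orbit (x : X) : Measurable fun t => S t x :=
  hS.measurable_uncurry.comp measurable_prodMk_right

theorem iterate (k : ℕ) (x : X) : (S 1)^[k] x = S k x := by
  induction k with
  | zero => simp [hS.map_zero]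
  | succ k ih => rw [Function.iterate_succ_apply', ih, ← hS.map_add, Nat.cast_succ, add_comm]

variable {f : X → ℝ} (hf : Measurable f) {C : ℝ} (hC : ∀ x, |f x| ≤ C)

include hf

theorem measurable_comp_orbit_uncurry : Measurable (Function.uncurry fun x t => f (S t x)) :=
  hf.comp (hS.measurable_uncurry.comp measurable_swap)

include hC

theorem birkhoffSum_integral (n : ℕ) (x : X) :
    birkhoffSum (S 1) (fun x => ∫ t in (0 : ℝ)..1, f (S t x)) n x =
      ∫ t in (0 : ℝ)..n, f (S t x) := by
  have hi := intervalIntegrable_of_abs_le (hf.comp (hS.measurable_orbit x)) fun t => hC (S t x)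
  have h_sum := intervalIntegral.sum_integral_adjacent_intervals (a := fun k : ℕ => (k : ℝ))
    (n := n) fun k _ => hi k (k + 1 : ℕ)
  rw [Nat.cast_zero] at h_sum
  refine Eq.trans (Finset.sum_congr rfl fun k _ => ?_) h_sum
  simp only [hS.iterate, ← hS.map_add, Function.comp_def]
  rw [intervalIntegral.integral_comp_add_right fun t => f (S t x)]
  push_cast
  rw [zero_add, add_comm]

theorem cesaroLimsup_apply (s : ℝ) (x : X) :
    cesaroLimsup (fun t => f (S t (S s x))) = cesaroLimsup fun t => f (S t x) := by
  simpa only [Function.comp_def, hS.map_add] using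
    cesaroLimsup_shift (hf.comp (hS.measurable_orbit x)) (fun t => hC (S t x)) s

variable {P : Measure X} [IsFiniteMeasure P] (hP : ∀ t, MeasurePreserving (S t) P P)

include hP

theorem integral_intervalIntegral :
    ∫ x, (∫ t in (0 : ℝ)..1, f (S t x)) ∂P = ∫ x, f x ∂P := by
  have : IsFiniteMeasure ((volume.restrict (uIoc (0 : ℝ) 1)).prod P) := by
    rw [uIoc]
    infer_instance
  have h_int : Integrable (Function.uncurry fun t x => f (S t x))
      ((volume.restrict (uIoc 0 1)).prod P) :=
    Integrable.of_bound (hf.comp hS.measurable_uncurry).aestronglyMeasurable C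
      (Eventually.of_forall fun p => hC _)
  rw [← intervalIntegral_integral_swap h_int]
  simp [integral_comp_of_measurePreserving (hP _) hf.aestronglyMeasurable]

theorem integral_cesaroLimsup_le :
    ∫ x, cesaroLimsup (fun t => f (S t x)) ∂P ≤ ∫ x, f x ∂P := by
  let F x := ∫ t in (0 : ℝ)..1, f (S t x)
  let G x := cesaroLimsup fun t => f (S t x)
  have hFm : Measurable F := measurable_intervalIntegral (hS.measurable_comp_orbit_uncurry hf) 0 1
  have hGm : Measurable G := measurable_cesaroLimsup (hS.measurable_comp_orbit_uncurry hf)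
  have hF : Integrable F P := Integrable.of_bound hFm.aestronglyMeasurable C
    (Eventually.of_forall fun x => by
      simpa using abs_integral_le_of_abs_le (fun t => hC (S t x)) 0 1)
  have hG : Integrable G P := Integrable.of_bound hGm.aestronglyMeasurable C
    (Eventually.of_forall fun x => abs_cesaroLimsup_le fun t => hC (S t x))
  refine le_of_forall_pos_le_add fun δ hδ => ?_
  obtain ⟨ε, hε, hεδ⟩ : ∃ ε > 0, ε * P.real univ < δ := by
    simpa only [mul_comm] using exists_pos_mul_lt hδ (P.real univ)
  have hGε : Integrable (fun x => G x - ε) P := hG.sub (integrable_const ε)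
  have h_sum n x : birkhoffSum (S 1) (F - fun x => G x - ε) n x =
      (∫ t in (0 : ℝ)..n, f (S t x)) - n * (G x - ε) := by
    rw [birkhoffSum_sub, hS.birkhoffSum_integral hf hC, birkhoffSum_of_comp_eq]
    · simp
    · funext x
      simp only [Function.comp_apply, G, hS.cesaroLimsup_apply hf hC]
  -- Some Birkhoff sum of `F - (G - ε)` is positive: `G` is the upper limit of the averages of `f`.
  have h_nonneg := integral_nonneg_of_ae_exists_birkhoffSum_pos (hP 1) (hFm.sub (hGm.sub_const ε))
    (hF.sub hGε) <| Eventually.of_forall fun x => by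
      have h_freq := frequently_lt_of_lt_limsup
        (isBoundedUnder_cesaro fun t => hC (S t x)).2.isCoboundedUnder_le (sub_lt_self (G x) hε)
      obtain ⟨n, hn, hn1⟩ := (h_freq.and_eventually (eventually_ge_atTop 1)).exists
      have hn0 : (0 : ℝ) < n := by exact_mod_cast hn1
      rw [cesaro_eq_inv_mul, inv_mul_eq_div, lt_div_iff₀ hn0] at hn
      exact ⟨n, by rw [h_sum]; linarith⟩
  simp only [Pi.sub_apply] at h_nonneg
  rw [integral_sub hF hGε, integral_sub hG (integrable_const ε),
    hS.integral_intervalIntegral hf hC hP, integral_const, smul_eq_mul] at h_nonneg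
  linarith

theorem ae_cesaroLimsup_le_condExp :
    ∀ᵐ x ∂P, cesaroLimsup (fun t => f (S t x)) ≤ (P[f|flowInvariants S]) x := by
  have hm := flowInvariants_le S
  have hf_int : Integrable f P :=
    Integrable.of_bound hf.aestronglyMeasurable C (Eventually.of_forall hC)
  have hG : Measurable[flowInvariants S] fun x => cesaroLimsup fun t => f (S t x) :=
    measurable_flowInvariants (measurable_cesaroLimsup (hS.measurable_comp_orbit_uncurry hf))
      (hS.cesaroLimsup_apply hf hC)
  have hG_int : Integrable (fun x => cesaroLimsup fun t => f (S t x)) P :=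
    Integrable.of_bound (hG.mono hm le_rfl).aestronglyMeasurable C
      (Eventually.of_forall fun x => abs_cesaroLimsup_le fun t => hC (S t x))
  refine ae_le_of_ae_le_trim (hm := hm) (ae_le_of_forall_setIntegral_le
    (hG_int.trim hm hG.stronglyMeasurable)
    (integrable_condExp.trim hm stronglyMeasurable_condExp) fun E hE _ => ?_)
  rw [← setIntegral_trim hm hG.stronglyMeasurable hE,
    ← setIntegral_trim hm stronglyMeasurable_condExp hE, setIntegral_condExp hm hf_int hE]
  exact hS.integral_cesaroLimsup_le hf hC (measurePreserving_restrict_of_invariant hP hE)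

theorem ae_tendsto_cesaro_condExp :
    ∀ᵐ x ∂P, Tendsto (fun n : ℕ => cesaro (fun t => f (S t x)) n) atTop
      (𝓝 ((P[f|flowInvariants S]) x)) := by
  filter_upwards [hS.ae_cesaroLimsup_le_condExp hf hC hP,
    hS.ae_cesaroLimsup_le_condExp (f := -f) hf.neg (by simpa using hC) hP,
    condExp_neg f (flowInvariants S) (μ := P)] with x h_le h_ge h_neg
  rw [h_neg] at h_ge
  exact tendsto_cesaro_of_cesaroLimsup_le (fun t => hC (S t x)) h_le h_ge

end IsMeasurableFlow

end Flow

/-! ### Conditional measures -/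

section ConditionalMeasures

theorem measurable_diag_of_le {X : Type*} {m mX : MeasurableSpace X} (hm : m ≤ mX) :
    @Measurable X (X × X) mX (m.prod mX) Function.diag :=
  (measurable_id'' hm).prodMk measurable_id

variable {X : Type*} {m : MeasurableSpace X} [mX : MeasurableSpace X] [StandardBorelSpace X]
  {P : Measure X} [IsFiniteMeasure P] (hm : m ≤ mX)

include hm

theorem ae_ae_condExpKernel {p : X → Prop} (hp : ∀ᵐ x ∂P, p x) :
    ∀ᵐ x ∂P, ∀ᵐ y ∂condExpKernel P m x, p y := by
  rw [← condExpKernel_comp_trim (μ := P) hm] at hp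
  exact ae_of_ae_trim hm (Measure.ae_ae_of_ae_comp hp)

theorem ae_ae_condExpKernel_eq {β : Type*} [MeasurableSpace β] [MeasurableEq β] {c : X → β}
    (hc : Measurable[m] c) : ∀ᵐ x ∂P, ∀ᵐ y ∂condExpKernel P m x, c y = c x := by
  have h_meas : MeasurableSet[m.prod mX] {p : X × X | c p.2 = c p.1} :=
    measurableSet_eq_fun (m := m.prod mX) ((hc.mono hm le_rfl).comp measurable_snd)
      (hc.comp measurable_fst)
  have h_ae : ∀ᵐ p ∂(P.trim hm ⊗ₘ condExpKernel P m), c p.2 = c p.1 := by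
    rw [compProd_trim_condExpKernel hm]
    exact (@ae_map_iff X (X × X) mX (m.prod mX) P Function.diag
      (@Measurable.aemeasurable X (X × X) mX (m.prod mX) _ P (measurable_diag_of_le hm))
      _ h_meas).2 (Eventually.of_forall fun x => rfl)
  exact ae_of_ae_trim hm (Measure.ae_ae_of_ae_compProd h_ae)

theorem setLIntegral_condExpKernel_apply {A B : Set X} (hA : MeasurableSet[m] A)
    (hB : MeasurableSet B) : ∫⁻ x in A, condExpKernel P m x B ∂P = P (A ∩ B) := by
  have h := DFunLike.congr_fun (compProd_trim_condExpKernel (μ := P) hm) (A ×ˢ B)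
  rw [Measure.compProd_apply_prod hA hB, restrict_trim hm _ hA,
    lintegral_trim hm (measurable_condExpKernel hB)] at h
  exact h.trans (@Measure.map_apply X (X × X) mX (m.prod mX) P _ (measurable_diag_of_le hm) _
    (@MeasurableSet.prod X X m mX A B hA hB))

theorem ae_eq_condExpKernel {κ : Kernel[m, mX] X X} [IsFiniteKernel κ]
    (h : ∀ A, MeasurableSet[m] A → ∀ B, MeasurableSet B → ∫⁻ x in A, κ x B ∂P = P (A ∩ B)) :
    ∀ᵐ x ∂P, κ x = condExpKernel P m x := by
  refine ae_of_ae_trim hm (Kernel.ae_eq_of_compProd_eq (Measure.ext_prod fun {A B} hA hB => ?_))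
  rw [Measure.compProd_apply_prod hA hB, Measure.compProd_apply_prod hA hB, restrict_trim hm _ hA,
    lintegral_trim hm (κ.measurable_coe hB), lintegral_trim hm (measurable_condExpKernel hB),
    h A hA B hB, setLIntegral_condExpKernel_apply hm hA hB]

theorem ae_condExpKernel_apply_eq_one {A : Set X} (hA : MeasurableSet[m] A) :
    ∀ᵐ x ∂P, x ∈ A → condExpKernel P m x A = 1 := by
  filter_upwards [ae_ae_condExpKernel_eq (P := P) (c := (· ∈ A)) hm
    (@MeasurableSet.mem X A m hA)] with x hx hxA
  exact (mem_ae_iff_prob_eq_one (hm A hA)).1 (hx.mono fun y hy => hy.mpr hxA)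

theorem ae_eq_condExpKernel_of_carried {κ : Kernel[m, mX] X X} [IsMarkovKernel κ]
    (h_barycenter : ∀ B, MeasurableSet B → ∫⁻ x, κ x B ∂P = P B)
    (h_carried : ∀ A, MeasurableSet[m] A → ∀ᵐ x ∂P, x ∈ A → κ x A = 1) :
    ∀ᵐ x ∂P, κ x = condExpKernel P m x := by
  refine ae_eq_condExpKernel hm fun A hA B hB => ?_
  have hAm := hm A hA
  rw [← h_barycenter _ (hAm.inter hB), ← lintegral_indicator hAm]
  refine lintegral_congr_ae ?_
  filter_upwards [h_carried A hA, h_carried Aᶜ hA.compl] with x hx hx_compl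
  by_cases hxA : x ∈ A
  · rw [indicator_of_mem hxA]
    exact (Measure.measure_inter_eq_of_ae ((mem_ae_iff_prob_eq_one hAm).2 (hx hxA))).symm
  · rw [indicator_of_notMem hxA]
    exact (measure_mono_null inter_subset_left
      ((prob_compl_eq_one_iff hAm).1 (hx_compl hxA))).symm

theorem ae_map_condExpKernel_eq {T : X → X} (hT : MeasurePreserving T P P)
    (hT_inv : ∀ A, MeasurableSet[m] A → T ⁻¹' A = A) :
    ∀ᵐ x ∂P, (condExpKernel P m x).map T = condExpKernel P m x := by
  have h := ae_eq_condExpKernel (P := P) hm (κ := (condExpKernel P m).map T) fun A hA B hB => by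
    simp_rw [Kernel.map_apply' _ hT.measurable _ hB]
    rw [setLIntegral_condExpKernel_apply hm hA (hT.measurable hB),
      ← hT.measure_preimage ((hm A hA).inter hB).nullMeasurableSet, preimage_inter, hT_inv A hA]
  simpa only [Kernel.map_apply _ hT.measurable] using h

end ConditionalMeasures

/-! ### The ergodic decomposition of a flow -/

section ErgodicDecomposition

theorem exists_countable_piSystem (X : Type*) [m : MeasurableSpace X]
    [MeasurableSpace.CountablyGenerated X] :
    ∃ 𝒞 : Set (Set X), 𝒞.Countable ∧ IsPiSystem 𝒞 ∧ m = MeasurableSpace.generateFrom 𝒞 := by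
  refine ⟨generateSetAlgebra (MeasurableSpace.countableGeneratingSet X),
    countable_generateSetAlgebra MeasurableSpace.countable_countableGeneratingSet,
    fun s hs t ht _ => isSetAlgebra_generateSetAlgebra.inter_mem hs ht, ?_⟩
  rw [generateFrom_generateSetAlgebra_eq, MeasurableSpace.generateFrom_countableGeneratingSet]

theorem exists_mem_sub_mem_of_ae {p : ℝ → Prop} (hp : ∀ᵐ t, p t) (s : ℝ) :
    ∃ t, p t ∧ p (s - t) :=
  (hp.and ((Measure.measurePreserving_sub_left volume s).quasiMeasurePreserving.ae hp)).exists

theorem abs_indicator_one_le {X : Type*} (B : Set X) (x : X) : |B.indicator (1 : X → ℝ) x| ≤ 1 := by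
  by_cases hx : x ∈ B <;> simp [hx]

variable {X : Type*} [MeasurableSpace X] {S : ℝ → X → X}

theorem measurePreserving_restrict_of_symmDiff {T : X → X} {Q : Measure X} {A : Set X}
    (hT : MeasurePreserving T Q Q) (hA : MeasurableSet A) (hTA : Q (symmDiff (T ⁻¹' A) A) = 0) :
    MeasurePreserving T (Q.restrict A) (Q.restrict A) := by
  simpa only [Measure.restrict_congr_set (measure_symmDiff_eq_zero_iff.1 hTA)] using
    hT.restrict_preimage hA

namespace IsMeasurableFlow

theorem measurePreserving_of_ae (hS : IsMeasurableFlow S) {Q : Measure X}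
    (h : ∀ᵐ t, Q.map (S t) = Q) (s : ℝ) : MeasurePreserving (S s) Q Q := by
  obtain ⟨t, ht, hst⟩ := exists_mem_sub_mem_of_ae h s
  have h_comp : S s = S (s - t) ∘ S t := by
    ext x
    rw [Function.comp_apply, ← hS.map_add, sub_add_cancel]
  rw [h_comp]
  exact (⟨hS.measurable _, hst⟩ : MeasurePreserving (S (s - t)) Q Q).comp ⟨hS.measurable t, ht⟩

theorem measurable_measure_preimage (hS : IsMeasurableFlow S) {A : Type*} [MeasurableSpace A]
    (κ : Kernel A X) [IsSFiniteKernel κ] {B : Set X} (hB : MeasurableSet B) :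
    Measurable fun p : ℝ × A => κ p.2 (S p.1 ⁻¹' B) :=
  Kernel.measurable_kernel_prodMk_left (κ := κ.comap Prod.snd measurable_snd)
    (t := {q : (ℝ × A) × X | S q.1.1 q.2 ∈ B})
    (hS.measurable_uncurry.comp (by fun_prop : Measurable fun q : (ℝ × A) × X => (q.1.1, q.2)) hB)

theorem ae_measurePreserving_of_forall_ae_map_eq [MeasurableSpace.CountablyGenerated X]
    (hS : IsMeasurableFlow S) {A : Type*} [MeasurableSpace A] {μ : Measure A} [SFinite μ]
    {κ : Kernel A X} [IsFiniteKernel κ] (h : ∀ t, ∀ᵐ a ∂μ, (κ a).map (S t) = κ a) :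
    ∀ᵐ a ∂μ, ∀ t, MeasurePreserving (S t) (κ a) (κ a) := by
  obtain ⟨𝒞, h_countable, h_pi, h_gen⟩ := exists_countable_piSystem X
  have h_meas : ∀ B ∈ 𝒞, MeasurableSet B := fun B hB => by
    rw [h_gen]; exact MeasurableSpace.measurableSet_generateFrom hB
  have h_apply : ∀ B ∈ 𝒞, ∀ᵐ a ∂μ, ∀ᵐ t : ℝ, κ a (S t ⁻¹' B) = κ a B := fun B hB => by
    have h_eq : MeasurableSet {p : ℝ × A | κ p.2 (S p.1 ⁻¹' B) = κ p.2 B} :=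
      measurableSet_eq_fun (hS.measurable_measure_preimage κ (h_meas B hB))
        ((κ.measurable_coe (h_meas B hB)).comp measurable_snd)
    refine (Measure.ae_ae_comm h_eq).1 (Eventually.of_forall fun t => ?_)
    filter_upwards [h t] with a ha
    rw [← Measure.map_apply (hS.measurable t) (h_meas B hB), ha]
  filter_upwards [(ae_ball_iff h_countable).2 h_apply] with a ha
  refine hS.measurePreserving_of_ae ?_
  filter_upwards [(ae_ball_iff h_countable).2 ha] with t ht
  refine ext_of_generate_finite 𝒞 h_gen h_pi (fun B hB => ?_) ?_
  · rw [Measure.map_apply (hS.measurable t) (h_meas B hB), ht B hB]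
  · rw [Measure.map_apply (hS.measurable t) .univ, preimage_univ]

theorem integral_eq_of_ae_tendsto_cesaro (hS : IsMeasurableFlow S) {Q : Measure X}
    [IsFiniteMeasure Q] (hQ : ∀ t, MeasurePreserving (S t) Q Q) {f c : X → ℝ} (hf : Measurable f)
    {C : ℝ} (hC : ∀ x, |f x| ≤ C)
    (hlim : ∀ᵐ x ∂Q, Tendsto (fun n : ℕ => cesaro (fun t => f (S t x)) n) atTop (𝓝 (c x))) :
    ∫ x, f x ∂Q = ∫ x, c x ∂Q := by
  rw [← integral_condExp (flowInvariants_le S)]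
  refine integral_congr_ae ?_
  filter_upwards [hlim, hS.ae_tendsto_cesaro_condExp hf hC hQ] with x h h'
  exact tendsto_nhds_unique h' h

theorem measure_eq_zero_or_one_of_tendsto_cesaro (hS : IsMeasurableFlow S) {Q : Measure X}
    [IsProbabilityMeasure Q] (hQ : ∀ t, MeasurePreserving (S t) Q Q) {𝒞 : Set (Set X)}
    (h_pi : IsPiSystem 𝒞) (h_gen : ‹MeasurableSpace X› = MeasurableSpace.generateFrom 𝒞)
    (hlim : ∀ B ∈ 𝒞, ∀ᵐ x ∂Q, Tendsto
      (fun n : ℕ => cesaro (fun t => B.indicator 1 (S t x)) n) atTop (𝓝 (Q.real B)))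
    {A : Set X} (hA : MeasurableSet A) (hSA : ∀ t, Q (symmDiff (S t ⁻¹' A) A) = 0) :
    Q A = 0 ∨ Q A = 1 := by
  have h_indep : ∀ B ∈ 𝒞, Q (B ∩ A) = Q B * Q A := fun B hB => by
    have hBm : MeasurableSet B := by
      rw [h_gen]; exact MeasurableSpace.measurableSet_generateFrom hB
    have h_eq := hS.integral_eq_of_ae_tendsto_cesaro (C := 1)
      (fun t => measurePreserving_restrict_of_symmDiff (hQ t) hA (hSA t))
      (measurable_one.indicator hBm) (abs_indicator_one_le B) (ae_restrict_of_ae (hlim B hB))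
    rw [integral_indicator_one hBm, measureReal_restrict_apply hBm, setIntegral_const, smul_eq_mul,
      mul_comm] at h_eq
    rw [← ofReal_measureReal, h_eq, ENNReal.ofReal_mul measureReal_nonneg, ofReal_measureReal,
      ofReal_measureReal]
  have h_gen_indep := Indep.symm <| IndepSets.indep' (p1 := 𝒞) (p2 := {A}) (μ := Q)
    (fun B hB => by rw [h_gen]; exact .basic B hB) (by simpa using hA) h_pi (.singleton A)
    ((IndepSets_iff _ _ _).2 (by rintro B _ hB rfl; exact h_indep B hB))
  exact measure_eq_zero_or_one_of_indepSet_self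
    (h_gen_indep.indepSet_of_measurableSet (.basic A rfl) (h_gen ▸ hA))

section

variable [StandardBorelSpace X] (hS : IsMeasurableFlow S) {P : Measure X} [IsFiniteMeasure P]
  (hP : ∀ t, MeasurePreserving (S t) P P)

include hS hP

theorem ae_condExpKernel_invariant :
    ∀ᵐ x ∂P, ∀ t, MeasurePreserving (S t) (condExpKernel P (flowInvariants S) x)
      (condExpKernel P (flowInvariants S) x) := by
  have hm := flowInvariants_le S
  exact hS.ae_measurePreserving_of_forall_ae_map_eq
    (κ := (condExpKernel P (flowInvariants S)).comap id (measurable_id'' hm)) fun t =>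
      ae_map_condExpKernel_eq hm (hP t) fun A hA => (measurableSet_flowInvariants.1 hA).2 t

theorem ae_tendsto_cesaro_integral_condExpKernel {f : X → ℝ} (hf : Measurable f) {C : ℝ}
    (hC : ∀ x, |f x| ≤ C) :
    ∀ᵐ x ∂P, Tendsto (fun n : ℕ => cesaro (fun t => f (S t x)) n) atTop
      (𝓝 (∫ y, f y ∂condExpKernel P (flowInvariants S) x)) := by
  filter_upwards [hS.ae_tendsto_cesaro_condExp hf hC hP,
    condExp_ae_eq_integral_condExpKernel (flowInvariants_le S)
      (Integrable.of_bound hf.aestronglyMeasurable C (Eventually.of_forall hC))] with x hx h_eq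
  rwa [h_eq] at hx

theorem ae_ae_tendsto_cesaro_integral_condExpKernel {f : X → ℝ} (hf : Measurable f) {C : ℝ}
    (hC : ∀ x, |f x| ≤ C) :
    ∀ᵐ x ∂P, ∀ᵐ y ∂condExpKernel P (flowInvariants S) x,
      Tendsto (fun n : ℕ => cesaro (fun t => f (S t y)) n) atTop
        (𝓝 (∫ z, f z ∂condExpKernel P (flowInvariants S) x)) := by
  have hm := flowInvariants_le S
  have h_meas : Measurable[flowInvariants S]
      fun x => ∫ z, f z ∂condExpKernel P (flowInvariants S) x :=
    (StronglyMeasurable.integral_kernel hf.stronglyMeasurable).measurable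
  filter_upwards [ae_ae_condExpKernel hm (hS.ae_tendsto_cesaro_integral_condExpKernel hP hf hC),
    ae_ae_condExpKernel_eq (P := P) hm h_meas] with x hx h_eq
  filter_upwards [hx, h_eq] with y hy h_eq
  rwa [h_eq] at hy

theorem ae_condExpKernel_ergodic :
    ∀ᵐ x ∂P, ∀ A, MeasurableSet A →
      (∀ t, condExpKernel P (flowInvariants S) x (symmDiff (S t ⁻¹' A) A) = 0) →
        condExpKernel P (flowInvariants S) x A = 0 ∨
          condExpKernel P (flowInvariants S) x A = 1 := by
  obtain ⟨𝒞, h_countable, h_pi, h_gen⟩ := exists_countable_piSystem X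
  have h_meas : ∀ B ∈ 𝒞, MeasurableSet B := fun B hB => by rw [h_gen]; exact .basic B hB
  filter_upwards [hS.ae_condExpKernel_invariant hP, (ae_ball_iff h_countable).2 fun B hB =>
    hS.ae_ae_tendsto_cesaro_integral_condExpKernel hP (measurable_one.indicator (h_meas B hB))
      (abs_indicator_one_le B)] with x h_inv hlim A hA hSA
  refine hS.measure_eq_zero_or_one_of_tendsto_cesaro h_inv h_pi h_gen (fun B hB => ?_) hA hSA
  simpa only [integral_indicator_one (h_meas B hB)] using hlim B hB

end

end IsMeasurableFlow

end ErgodicDecomposition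

/-! ### Joint measurability -/

section Kernels

variable {α β γ : Type*} [MeasurableSpace α] [MeasurableSpace β] [MeasurableSpace γ]

theorem isSFiniteKernel_of_isFiniteMeasure (κ : Kernel α β) [∀ a, IsFiniteMeasure (κ a)] :
    IsSFiniteKernel κ := by
  classical
  have h_meas (k : ℕ) : MeasurableSet {a | ⌊(κ a).real univ⌋₊ = k} :=
    Nat.measurable_floor.comp (κ.measurable_coe .univ).ennreal_toReal (measurableSet_singleton k)
  have h_finite (k : ℕ) : IsFiniteKernel (Kernel.piecewise (h_meas k) κ 0) := by
    refine ⟨ENNReal.ofReal (k + 1), ENNReal.ofReal_lt_top, fun a => ?_⟩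
    rw [Kernel.piecewise_apply']
    split_ifs with ha
    · rw [← ofReal_measureReal, ← show ⌊(κ a).real univ⌋₊ = k from ha]
      exact ENNReal.ofReal_le_ofReal (Nat.lt_floor_add_one _).le
    · exact zero_le
  have h_sum : κ = Kernel.sum fun k => Kernel.piecewise (h_meas k) κ 0 := by
    ext a s hs
    simp only [Kernel.sum_apply' _ _ hs, Kernel.piecewise_apply', mem_ofPred_eq,
      zero_apply, Measure.coe_zero, Pi.zero_apply]
    rw [tsum_eq_single ⌊(κ a).real univ⌋₊ fun k hk => if_neg hk.symm, if_pos rfl]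
  rw [h_sum]
  infer_instance

theorem isSFiniteKernel_of_isLocallyFiniteMeasure [TopologicalSpace β] [T2Space β]
    [SigmaCompactSpace β] [OpensMeasurableSpace β] (κ : Kernel α β)
    [∀ a, IsLocallyFiniteMeasure (κ a)] : IsSFiniteKernel κ := by
  let A := disjointed (compactCovering β)
  have hA n : MeasurableSet (A n) :=
    MeasurableSet.disjointed (fun k => (isCompact_compactCovering β k).measurableSet) n
  have h_finite n a : IsFiniteMeasure (κ.restrict (hA n) a) := by
    rw [Kernel.restrict_apply]
    exact isFiniteMeasure_restrict.2 (measure_ne_top_of_subset (disjointed_subset _ n)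
      (isCompact_compactCovering β n).measure_ne_top)
  have h_sum : κ = Kernel.sum fun n => κ.restrict (hA n) := by
    ext1 a
    simp only [Kernel.sum_apply, Kernel.restrict_apply]
    rw [← Measure.restrict_iUnion (disjoint_disjointed _) hA, iUnion_disjointed,
      iUnion_compactCovering, Measure.restrict_univ]
  have h_restrict n : IsSFiniteKernel (κ.restrict (hA n)) := isSFiniteKernel_of_isFiniteMeasure _
  rw [h_sum]
  infer_instance

theorem measurable_map_kernel (κ : Kernel α β) [IsSFiniteKernel κ] {g : α → β → γ}
    (hg : Measurable (Function.uncurry g)) : Measurable fun a => (κ a).map (g a) := by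
  refine Measure.measurable_of_measurable_coe _ fun s hs => ?_
  have hg_left a : Measurable (g a) := hg.comp measurable_prodMk_left
  simp_rw [Measure.map_apply (hg_left _) hs]
  exact Kernel.measurable_kernel_prodMk_left (hg hs)

end Kernels

section Measurability

variable {d : ℕ}

/-- The tautological kernel `μ ↦ μ` on the phase space. -/
def phaseKernel (d : ℕ) : Kernel (Phase d) (Fin d → ℝ) :=
  ⟨Subtype.val, measurable_subtype_coe⟩

instance isSFiniteKernel_phaseKernel : IsSFiniteKernel (phaseKernel d) :=
  have (μ : Phase d) : IsLocallyFiniteMeasure (phaseKernel d μ) := μ.2.1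
  isSFiniteKernel_of_isLocallyFiniteMeasure _

theorem measurable_map_phase {α β : Type*} [MeasurableSpace α] [MeasurableSpace β]
    {m : α → Phase d} (hm : Measurable m) {g : α → (Fin d → ℝ) → β}
    (hg : Measurable (Function.uncurry g)) : Measurable fun a => (m a).1.map (g a) :=
  measurable_map_kernel ((phaseKernel d).comap m hm) hg

theorem measurable_normStar :
    Measurable (normStar : Measure (Fin d → ℝ) → Measure (Fin d → ℝ)) := by
  refine Measure.measurable_of_measurable_coe _ fun s hs => ?_
  simp_rw [normStar, Measure.smul_apply, smul_eq_mul]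
  exact (Measure.measurable_coe (measurableSet_unitBall d)).inv.mul (Measure.measurable_coe hs)

theorem scale_transl (t : ℝ) (x : Fin d → ℝ) (μ : Measure (Fin d → ℝ)) :
    scale t (transl x μ) = μ.map fun y => Real.exp t • (y - x) :=
  Measure.map_map (by fun_prop) (by fun_prop)

theorem measurable_scenery_uncurry :
    Measurable fun p : (Phase d × (Fin d → ℝ)) × ℝ => scenery p.1.1.1 p.1.2 p.2 := by
  simp_rw [scenery, scale_transl]
  refine (measurable_box d).comp (measurable_map_phase (measurable_fst.comp measurable_fst) ?_)
  simp only [Function.uncurry_def]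
  fun_prop

theorem measurable_flow_uncurry : Measurable (Function.uncurry (flow (d := d))) := by
  refine Measurable.subtype_mk
    (measurable_normStar.comp (measurable_map_phase measurable_snd ?_))
  simp only [Function.uncurry_def]
  fun_prop

theorem measurable_translStar_uncurry :
    Measurable (Function.uncurry fun (μ : Phase d) x => translStar x μ.1) := by
  refine measurable_normStar.comp (measurable_map_phase measurable_fst ?_)
  simp only [Function.uncurry_def]
  fun_prop

theorem measurable_translStar (μ : Phase d) : Measurable fun x => translStar x μ.1 :=
  measurable_translStar_uncurry.of_uncurry_left

theorem measurable_diffusion {U : Set (Fin d → ℝ)} (hU : MeasurableSet U) :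
    Measurable fun μ : Phase d => diffusion U μ.1 :=
  measurable_map_kernel ((phaseKernel d).restrict hU) measurable_translStar_uncurry

end Measurability

/-! ### The scaling flow -/

section ScalingFlow

variable {d : ℕ} {c : ENNReal}

theorem normStar_smul (hc₀ : c ≠ 0) (hc : c ≠ ⊤) (μ : Measure (Fin d → ℝ)) :
    normStar (c • μ) = normStar μ := by
  rw [normStar, normStar, Measure.smul_apply, smul_eq_mul, smul_smul,
    ENNReal.mul_inv (Or.inl hc₀) (Or.inl hc), mul_right_comm, ENNReal.inv_mul_cancel hc₀ hc,
    one_mul]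

theorem boxMeasure_smul (hc₀ : c ≠ 0) (hc : c ≠ ⊤) (μ : Measure (Fin d → ℝ)) :
    boxMeasure (c • μ) = boxMeasure μ := by
  have h_iff : ((c • μ) (unitBall d) ≠ 0 ∧ (c • μ) (unitBall d) ≠ ⊤) ↔
      (μ (unitBall d) ≠ 0 ∧ μ (unitBall d) ≠ ⊤) := by
    simp [ENNReal.mul_eq_top, hc₀, hc]
  refine if_congr h_iff ?_ rfl
  rw [Measure.comap_smul, Measure.smul_apply, smul_eq_mul, smul_smul,
    ENNReal.mul_inv (Or.inl hc₀) (Or.inl hc), mul_right_comm, ENNReal.inv_mul_cancel hc₀ hc,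
    one_mul]

theorem box_smul (hc₀ : c ≠ 0) (hc : c ≠ ⊤) (μ : Measure (Fin d → ℝ)) :
    box (c • μ) = box μ :=
  Subtype.ext (boxMeasure_smul hc₀ hc μ)

theorem scale_smul (t : ℝ) (c : ENNReal) (μ : Measure (Fin d → ℝ)) :
    scale t (c • μ) = c • scale t μ :=
  Measure.map_smul _ _ _

theorem scale_scale (s t : ℝ) (μ : Measure (Fin d → ℝ)) :
    scale s (scale t μ) = scale (s + t) μ := by
  rw [scale, scale, scale, Measure.map_map (by fun_prop) (by fun_prop)]
  simp only [Function.comp_def, smul_smul, Real.exp_add]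

theorem scale_zero (μ : Measure (Fin d → ℝ)) : scale 0 μ = μ := by
  simp only [scale, Real.exp_zero, one_smul, Measure.map_id']

theorem preimage_exp_smul_closedBall (t r : ℝ) :
    (fun y : Fin d → ℝ => Real.exp t • y) ⁻¹' Metric.closedBall 0 r =
      Metric.closedBall 0 (Real.exp (-t) * r) := by
  ext y
  simp only [mem_preimage, mem_closedBall_zero_iff, norm_smul, Real.norm_eq_abs, Real.abs_exp,
    Real.exp_neg]
  rw [le_inv_mul_iff₀ (Real.exp_pos t)]

theorem scale_unitBall (t : ℝ) (μ : Measure (Fin d → ℝ)) :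
    scale t μ (unitBall d) = μ (Metric.closedBall 0 (Real.exp (-t))) := by
  rw [scale_apply t μ (measurableSet_unitBall d), unitBall, preimage_exp_smul_closedBall, mul_one]

theorem measure_closedBall_ne_zero {μ : Measure (Fin d → ℝ)} {x : Fin d → ℝ} (hx : x ∈ μ.support)
    {r : ℝ} (hr : 0 < r) : μ (Metric.closedBall x r) ≠ 0 :=
  ((Measure.mem_support_iff_forall x).1 hx _ (Metric.closedBall_mem_nhds x hr)).ne'

/-- The factor by which `S_t μ` is renormalized in `S_t^* μ`. -/
def flowFactor (t : ℝ) (μ : Phase d) : ENNReal := (scale t μ.1 (unitBall d))⁻¹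

theorem flowFactor_ne_zero (t : ℝ) (μ : Phase d) : flowFactor t μ ≠ 0 := by
  rw [flowFactor, scale_unitBall]
  exact ENNReal.inv_ne_zero.2 (isCompact_closedBall 0 _).measure_ne_top

theorem flowFactor_ne_top (t : ℝ) (μ : Phase d) : flowFactor t μ ≠ ⊤ := by
  rw [flowFactor, scale_unitBall]
  exact ENNReal.inv_ne_top.2 (measure_closedBall_ne_zero μ.2.2.2 (Real.exp_pos _))

theorem coe_flow (t : ℝ) (μ : Phase d) : (flow t μ).1 = flowFactor t μ • scale t μ.1 := rfl

theorem isMeasurableFlow_flow : IsMeasurableFlow (flow (d := d)) where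
  measurable_uncurry := measurable_flow_uncurry
  map_add s t μ := by
    refine Subtype.ext ?_
    change normStar (scale (s + t) μ.1) = normStar (scale s (flow t μ).1)
    rw [coe_flow, scale_smul, scale_scale,
      normStar_smul (flowFactor_ne_zero t μ) (flowFactor_ne_top t μ)]
  map_zero μ := by
    refine Subtype.ext ?_
    rw [coe_flow, flowFactor, scale_zero, μ.2.2.1, inv_one, one_smul]

theorem box_flow (t : ℝ) (μ : Phase d) : box (flow t μ).1 = box (scale t μ.1) :=
  box_smul (flowFactor_ne_zero t μ) (flowFactor_ne_top t μ) _

end ScalingFlow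

/-! ### The phase space is standard Borel -/

section StandardBorel

theorem measurableEmbedding_of_leftInvOn {X Y : Type*} [MeasurableSpace X] [MeasurableSpace Y]
    [MeasurableEq Y] {f : X → Y} {g : Y → X} {s : Set X} (hf : Measurable f) (hg : Measurable g)
    (hs : MeasurableSet s) (h : LeftInvOn g f s) : MeasurableEmbedding fun x : s => f x where
  injective x y hxy := Subtype.ext (h.injOn x.2 y.2 hxy)
  measurable := hf.comp measurable_subtype_coe
  measurableSet_image' A hA := by
    have h_image : (fun x : s => f x) '' A =
        g ⁻¹' (Subtype.val '' A) ∩ {y | f (g y) = y} := by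
      ext y
      constructor
      · rintro ⟨x, hx, rfl⟩
        exact ⟨⟨x, hx, (h x.2).symm⟩, congrArg f (h x.2)⟩
      · rintro ⟨⟨x, hx, hxy⟩, hy⟩
        exact ⟨x, hx, (congrArg f hxy).trans hy⟩
    rw [h_image]
    exact (hg ((MeasurableEmbedding.subtype_coe hs).measurableSet_image.2 hA)).inter
      (measurableSet_eq_fun (hf.comp hg) measurable_id)

theorem standardBorelSpace_of_measurableEmbedding {X Y : Type*} [MeasurableSpace X]
    [MeasurableSpace Y] [StandardBorelSpace Y] {f : X → Y} (hf : MeasurableEmbedding f) :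
    StandardBorelSpace X := by
  have := hf.measurableSet_range.standardBorel
  let e : X ≃ᵐ range f := hf.equivRange
  let := upgradeStandardBorel (range f)
  let : TopologicalSpace X := TopologicalSpace.induced e inferInstance
  have : BorelSpace X := ⟨e.measurableEmbedding.comap_eq.symm.trans
    ((congrArg (MeasurableSpace.comap e) BorelSpace.measurable_eq).trans borel_comap.symm)⟩
  have : PolishSpace X := e.toEquiv.polishSpace_induced
  infer_instance

theorem measurableSpace_probabilityMeasure_le_borel {X : Type*} [TopologicalSpace X]
    [MeasurableSpace X] [BorelSpace X] [HasOuterApproxClosed X] :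
    (inferInstance : MeasurableSpace (ProbabilityMeasure X)) ≤ borel (ProbabilityMeasure X) := by
  let : MeasurableSpace (ProbabilityMeasure X) := borel _
  have : BorelSpace (ProbabilityMeasure X) := ⟨rfl⟩
  have h_val : Measurable fun μ : ProbabilityMeasure X => (μ : Measure X) := by
    refine Measurable.measure_of_isPiSystem_of_isProbabilityMeasure
      (borel_eq_generateFrom_isClosed (α := X) ▸ BorelSpace.measurable_eq) isPiSystem_isClosed
      fun F hF => ?_
    refine measurable_of_tendsto_metrizable
      (f := fun n (μ : ProbabilityMeasure X) => ∫⁻ x, hF.apprSeq n x ∂(μ : Measure X)) (fun n => ?_)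
      (tendsto_pi_nhds.2 fun μ => HasOuterApproxClosed.tendsto_lintegral_apprSeq hF μ)
    convert (ENNReal.continuous_coe.comp
      (ProbabilityMeasure.continuous_testAgainstNN_eval (hF.apprSeq n))).measurable using 2 with μ
    exact (FiniteMeasure.testAgainstNN_coe_eq (μ := μ.toFiniteMeasure)).symm
  exact h_val.comap_le

variable {d : ℕ}

instance borelSpace_probabilityMeasure (d : ℕ) : BorelSpace (ProbabilityMeasure (unitBall d)) :=
  ⟨measurableSpace_probabilityMeasure_le_borel.antisymm OpensMeasurableSpace.borel_le⟩

instance polishSpace_probabilityMeasure (d : ℕ) :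
    PolishSpace (ProbabilityMeasure (unitBall d)) := by
  let := TopologicalSpace.metrizableSpaceMetric (ProbabilityMeasure (unitBall d))
  infer_instance

/-- The closed ball of radius `e^n` about the origin. -/
def expBall (d n : ℕ) : Set (Fin d → ℝ) := Metric.closedBall 0 (Real.exp n)

theorem measurableSet_expBall (d n : ℕ) : MeasurableSet (expBall d n) :=
  Metric.isClosed_closedBall.measurableSet

theorem expBall_mem_nhds {x : Fin d → ℝ} {n : ℕ} (hn : ‖x‖ ≤ n) : expBall d n ∈ 𝓝 x := by
  refine Metric.closedBall_mem_nhds_of_mem (mem_ball_zero_iff.2 ?_)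
  linarith [Real.add_one_le_exp (n : ℝ)]

theorem iUnion_expBall (d : ℕ) : ⋃ n, expBall d n = univ :=
  eq_univ_of_forall fun x =>
    mem_iUnion.2 ((exists_nat_ge ‖x‖).imp fun _ hn => mem_of_mem_nhds (expBall_mem_nhds hn))

theorem measurableSet_phase (d : ℕ) : MeasurableSet {μ : Measure (Fin d → ℝ) |
    IsLocallyFiniteMeasure μ ∧ μ (unitBall d) = 1 ∧ 0 ∈ μ.support} := by
  have h_locallyFinite (μ : Measure (Fin d → ℝ)) :
      IsLocallyFiniteMeasure μ ↔ ∀ n, μ (expBall d n) < ⊤ := by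
    refine ⟨fun _ n => (isCompact_closedBall 0 _).measure_lt_top, fun h => ⟨fun x => ?_⟩⟩
    obtain ⟨n, hn⟩ := exists_nat_ge ‖x‖
    exact ⟨expBall d n, expBall_mem_nhds hn, h n⟩
  have h_support (μ : Measure (Fin d → ℝ)) :
      0 ∈ μ.support ↔ ∀ n : ℕ, 0 < μ (Metric.ball 0 (1 / ((n : ℝ) + 1))) := by
    simp [Metric.nhds_basis_ball_inv_nat_succ.mem_measureSupport]
  simp_rw [h_locallyFinite, h_support, ofPred_and, ofPred_forall]
  refine .inter (.iInter fun n => ?_) (.inter ?_ (.iInter fun n => ?_))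
  · exact Measure.measurable_coe (measurableSet_expBall d n) measurableSet_Iio
  · exact Measure.measurable_coe (measurableSet_unitBall d) (measurableSet_singleton 1)
  · exact Measure.measurable_coe Metric.isOpen_ball.measurableSet measurableSet_Ioi

theorem restrict_unitBall_scale (t : ℝ) (μ : Measure (Fin d → ℝ)) :
    (scale t μ).restrict (unitBall d) =
      scale t (μ.restrict (Metric.closedBall 0 (Real.exp (-t)))) := by
  rw [scale, Measure.restrict_map (by fun_prop) (measurableSet_unitBall d), unitBall,
    preimage_exp_smul_closedBall, mul_one, scale]

theorem map_val_box {μ : Measure (Fin d → ℝ)} (h₀ : μ (unitBall d) ≠ 0) (h : μ (unitBall d) ≠ ⊤) :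
    (box μ : Measure (unitBall d)).map Subtype.val =
      (μ (unitBall d))⁻¹ • μ.restrict (unitBall d) := by
  change (boxMeasure μ).map _ = _
  rw [boxMeasure, if_pos ⟨h₀, h⟩, Measure.map_smul,
    (MeasurableEmbedding.subtype_coe (measurableSet_unitBall d)).map_comap, Subtype.range_coe]

/-- The restrictions of `μ` to the balls of radius `e^n`, rescaled to `B₁` and normalized. -/
def boxSeq (μ : Measure (Fin d → ℝ)) (n : ℕ) : ProbabilityMeasure (unitBall d) :=
  box (scale (-n) μ)

/-- The measure with given rescaled restrictions to the balls of radius `e^n`; a left inverse of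
`boxSeq` on the phase space. -/
def unboxSeq (p : ℕ → ProbabilityMeasure (unitBall d)) : Measure (Fin d → ℝ) :=
  Measure.sum fun n : ℕ => (normStar (scale n ((p n : Measure (unitBall d)).map
    Subtype.val))).restrict (disjointed (expBall d) n)

theorem measurable_scale (t : ℝ) : Measurable (scale (d := d) t) :=
  Measure.measurable_map _ (by fun_prop)

theorem measurable_boxSeq : Measurable (boxSeq (d := d)) :=
  measurable_pi_lambda _ fun _ => (measurable_box d).comp (measurable_scale _)

theorem measurable_unboxSeq : Measurable (unboxSeq (d := d)) := by
  have h_term (n : ℕ) : Measurable fun p : ℕ → ProbabilityMeasure (unitBall d) =>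
      normStar (scale n ((p n : Measure (unitBall d)).map Subtype.val)) :=
    measurable_normStar.comp ((measurable_scale n).comp
      ((Measure.measurable_map _ measurable_subtype_coe).comp
        (measurable_subtype_coe.comp (measurable_pi_apply n))))
  refine Measure.measurable_of_measurable_coe _ fun s hs => ?_
  simp_rw [unboxSeq, Measure.sum_apply _ hs, Measure.restrict_apply hs]
  exact Measurable.tsum fun n => (Measure.measurable_coe
    (hs.inter (.disjointed (measurableSet_expBall d) n))).comp (h_term n)

theorem normStar_scale_map_val_boxSeq (μ : Phase d) (n : ℕ) :
    normStar (scale n ((boxSeq μ.1 n : Measure (unitBall d)).map Subtype.val)) =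
      μ.1.restrict (expBall d n) := by
  have h₀ := ENNReal.inv_ne_top.1 (flowFactor_ne_top (-n) μ)
  have h := ENNReal.inv_ne_zero.1 (flowFactor_ne_zero (-n) μ)
  have h_subset : unitBall d ⊆ expBall d n :=
    Metric.closedBall_subset_closedBall (Real.one_le_exp n.cast_nonneg)
  rw [boxSeq, map_val_box h₀ h, scale_smul,
    normStar_smul (ENNReal.inv_ne_zero.2 h) (ENNReal.inv_ne_top.2 h₀), restrict_unitBall_scale,
    scale_scale, add_neg_cancel, scale_zero, neg_neg, ← expBall, normStar,
    Measure.restrict_apply (measurableSet_unitBall d), inter_eq_left.2 h_subset, μ.2.2.1, inv_one,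
    one_smul]

theorem unboxSeq_boxSeq (μ : Phase d) : unboxSeq (boxSeq μ.1) = μ.1 := by
  simp_rw [unboxSeq, normStar_scale_map_val_boxSeq,
    Measure.restrict_restrict_of_subset (disjointed_subset (expBall d) _)]
  rw [← Measure.restrict_iUnion (disjoint_disjointed _) (.disjointed (measurableSet_expBall d)),
    iUnion_disjointed, iUnion_expBall, Measure.restrict_univ]

instance standardBorelSpace_phase (d : ℕ) : StandardBorelSpace (Phase d) :=
  standardBorelSpace_of_measurableEmbedding (measurableEmbedding_of_leftInvOn measurable_boxSeq
    measurable_unboxSeq (measurableSet_phase d) fun μ hμ => unboxSeq_boxSeq ⟨μ, hμ⟩)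

end StandardBorel

/-! ### Mean oscillation -/

section MeanOscillation

variable {X E : Type*} [PseudoMetricSpace X] [MeasurableSpace X] [SeminormedAddCommGroup E]
  {μ : Measure X} {f : X → E} {x : X} {r : ℝ}

/-- The mean deviation of `f` from `f x` on the closed ball of radius `r` about `x`. -/
def meanOscillation (f : X → E) (μ : Measure X) (x : X) (r : ℝ) : ENNReal :=
  ⨍⁻ y in Metric.closedBall x r, ‖f y - f x‖ₑ ∂μ

theorem meanOscillation_smul_map {Y : Type*} [PseudoMetricSpace Y] [MeasurableSpace Y] {φ : X → Y}
    (hφ : MeasurableEmbedding φ) {c : ENNReal} (hc₀ : c ≠ 0) (hc : c ≠ ⊤) {y : Y} (hy : φ x = y)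
    {s : ℝ} (h_ball : φ ⁻¹' Metric.closedBall y s = Metric.closedBall x r) (f : Y → E) :
    meanOscillation f (c • μ.map φ) y s = meanOscillation (f ∘ φ) μ x r := by
  rw [meanOscillation, meanOscillation, setLAverage_eq, setLAverage_eq, Measure.restrict_smul,
    lintegral_smul_measure, Measure.smul_apply, hφ.restrict_map, hφ.lintegral_map, hφ.map_apply,
    h_ball, smul_eq_mul, smul_eq_mul, ENNReal.mul_div_mul_left _ _ hc₀ hc]
  simp only [Function.comp_apply, hy]

theorem meanOscillation_le {C : ℝ} (hC : ∀ y, ‖f y‖ ≤ C) :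
    meanOscillation f μ x r ≤ ENNReal.ofReal (2 * C) := by
  have h_bound (y : X) : ‖f y - f x‖ₑ ≤ ENNReal.ofReal (2 * C) := by
    rw [← ofReal_norm]
    exact ENNReal.ofReal_le_ofReal ((norm_sub_le _ _).trans (by linarith [hC x, hC y]))
  rw [meanOscillation, setLAverage_eq]
  refine ENNReal.div_le_of_le_mul ?_
  rw [← setLIntegral_const]
  exact lintegral_mono h_bound

end MeanOscillation

section LebesguePoints

variable {X E : Type*} [MetricSpace X] [MeasurableSpace X] [BorelSpace X] [NormedAddCommGroup E]
  {μ : Measure X} [IsLocallyFiniteMeasure μ] {f : X → E}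

theorem ae_tendsto_meanOscillation [SecondCountableTopology X] [HasBesicovitchCovering X]
    (hf : LocallyIntegrable f μ) :
    ∀ᵐ x ∂μ, Tendsto (meanOscillation f μ x) (𝓝[>] 0) (𝓝 0) := by
  filter_upwards [(Besicovitch.vitaliFamily μ).ae_tendsto_lintegral_enorm_sub_div hf] with x hx
  unfold meanOscillation
  simp_rw [setLAverage_eq]
  exact hx.comp (Besicovitch.tendsto_filterAt μ x)

theorem ae_restrict_eq_of_meanOscillation_eq_zero [ProperSpace X] [MeasurableSpace E] [BorelSpace E]
    (hf : AEMeasurable f μ) {x : X} {r : ℝ} (h : meanOscillation f μ x r = 0) :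
    ∀ᵐ y ∂μ.restrict (Metric.closedBall x r), f y = f x := by
  rw [meanOscillation, setLAverage_eq, ENNReal.div_eq_zero_iff] at h
  have h_zero := h.resolve_right (isCompact_closedBall x r).measure_ne_top
  rw [lintegral_eq_zero_iff' (hf.restrict.sub_const _).enorm] at h_zero
  filter_upwards [h_zero] with y hy
  exact sub_eq_zero.1 (enorm_eq_zero.1 hy)

end LebesguePoints

/-! ### Averages along sceneries -/

section Sceneries

variable {d : ℕ} {g : ProbabilityMeasure (unitBall d) → ℝ} {C : ℝ}

theorem scenery_smul {c : ENNReal} (hc₀ : c ≠ 0) (hc : c ≠ ⊤) (μ : Measure (Fin d → ℝ))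
    (y : Fin d → ℝ) (t : ℝ) : scenery (c • μ) y t = scenery μ y t := by
  rw [scenery, transl, Measure.map_smul, scale_smul, box_smul hc₀ hc, scenery, transl]

theorem scenery_transl (x y : Fin d → ℝ) (μ : Measure (Fin d → ℝ)) (t : ℝ) :
    scenery (transl x μ) y t = scenery μ (x + y) t := by
  rw [scenery, scenery, transl, transl, transl, Measure.map_map (by fun_prop) (by fun_prop)]
  simp only [Function.comp_def, sub_sub]

theorem scenery_scale (s : ℝ) (y : Fin d → ℝ) (μ : Measure (Fin d → ℝ)) (t : ℝ) :
    scenery (scale s μ) (Real.exp s • y) t = scenery μ y (t + s) := by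
  rw [scenery, scenery, scale_transl, scale_transl, scale,
    Measure.map_map (by fun_prop) (by fun_prop)]
  simp only [Function.comp_def, ← smul_sub, smul_smul, Real.exp_add]

theorem scenery_flow (s : ℝ) (y : Fin d → ℝ) (μ : Phase d) (t : ℝ) :
    scenery (flow s μ).1 (Real.exp s • y) t = scenery μ.1 y (t + s) := by
  rw [coe_flow, scenery_smul (flowFactor_ne_zero s μ) (flowFactor_ne_top s μ), scenery_scale]

theorem scenery_zero (μ : Phase d) (t : ℝ) : scenery μ.1 0 t = box (flow t μ).1 := by
  simp only [box_flow, scenery, transl, sub_zero, Measure.map_id']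

theorem transl_unitBall (x : Fin d → ℝ) (μ : Measure (Fin d → ℝ)) :
    transl x μ (unitBall d) = μ (Metric.closedBall x 1) := by
  rw [transl, Measure.map_apply (by fun_prop) (measurableSet_unitBall d)]
  congr 1
  ext y
  simp [unitBall, dist_eq_norm]

/-- The factor by which `T_x μ` is renormalized in `T_x^* μ`. -/
def translFactor (x : Fin d → ℝ) (μ : Measure (Fin d → ℝ)) : ENNReal :=
  (transl x μ (unitBall d))⁻¹

section Translation

variable {μ : Measure (Fin d → ℝ)} {x : Fin d → ℝ}

theorem translStar_eq_smul (x : Fin d → ℝ) (μ : Measure (Fin d → ℝ)) :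
    translStar x μ = translFactor x μ • μ.map fun y => y - x := rfl

theorem translFactor_ne_zero [IsLocallyFiniteMeasure μ] : translFactor x μ ≠ 0 := by
  rw [translFactor, transl_unitBall]
  exact ENNReal.inv_ne_zero.2 (isCompact_closedBall x 1).measure_ne_top

theorem translFactor_ne_top (hx : x ∈ μ.support) : translFactor x μ ≠ ⊤ := by
  rw [translFactor, transl_unitBall]
  exact ENNReal.inv_ne_top.2 (measure_closedBall_ne_zero hx one_pos)

theorem scenery_translStar [IsLocallyFiniteMeasure μ] (hx : x ∈ μ.support) (y : Fin d → ℝ)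
    (t : ℝ) : scenery (translStar x μ) y t = scenery μ (x + y) t := by
  rw [translStar_eq_smul, scenery_smul translFactor_ne_zero (translFactor_ne_top hx), ← transl,
    scenery_transl]

end Translation

/-- The upper limit of the averages of `g` along the scenery of `μ` at `x`. -/
def sceneryLimsup (g : ProbabilityMeasure (unitBall d) → ℝ) (μ : Measure (Fin d → ℝ))
    (x : Fin d → ℝ) : ℝ :=
  cesaroLimsup fun t => g (scenery μ x t)

theorem measurable_sceneryLimsup_uncurry (hg : Measurable g) :
    Measurable (Function.uncurry fun (μ : Phase d) x => sceneryLimsup g μ.1 x) :=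
  measurable_cesaroLimsup (hg.comp measurable_scenery_uncurry)

theorem measurable_sceneryLimsup (hg : Measurable g) (μ : Phase d) :
    Measurable (sceneryLimsup g μ.1) :=
  (measurable_sceneryLimsup_uncurry hg).of_uncurry_left

theorem abs_sceneryLimsup_le (hC : ∀ p, |g p| ≤ C) (μ : Measure (Fin d → ℝ)) (x : Fin d → ℝ) :
    |sceneryLimsup g μ x| ≤ C :=
  abs_cesaroLimsup_le fun _ => hC _

theorem sceneryLimsup_flow (hg : Measurable g) (hC : ∀ p, |g p| ≤ C) (s : ℝ) (μ : Phase d)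
    (y : Fin d → ℝ) :
    sceneryLimsup g (flow s μ).1 (Real.exp s • y) = sceneryLimsup g μ.1 y := by
  simp_rw [sceneryLimsup, scenery_flow]
  exact cesaroLimsup_shift (hg.comp (measurable_scenery μ.1 y)) (fun _ => hC _) s

theorem sceneryLimsup_translStar {μ : Measure (Fin d → ℝ)} [IsLocallyFiniteMeasure μ]
    {x : Fin d → ℝ} (hx : x ∈ μ.support) (y : Fin d → ℝ) :
    sceneryLimsup g (translStar x μ) y = sceneryLimsup g μ (x + y) := by
  simp_rw [sceneryLimsup, scenery_translStar hx]

/-- The mean oscillation of the upper scenery averages of `μ` over a ball. -/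
def sceneryOscillation (g : ProbabilityMeasure (unitBall d) → ℝ) (μ : Measure (Fin d → ℝ))
    (x : Fin d → ℝ) (r : ℝ) : ENNReal :=
  meanOscillation (sceneryLimsup g μ) μ x r

theorem measurable_sceneryOscillation (hg : Measurable g) (x : Fin d → ℝ) (r : ℝ) :
    Measurable fun μ : Phase d => sceneryOscillation g μ.1 x r := by
  have h_ball : MeasurableSet (Metric.closedBall x r) := Metric.isClosed_closedBall.measurableSet
  have h_limsup := measurable_sceneryLimsup_uncurry hg
  have h_enorm : Measurable (Function.uncurry fun (μ : Phase d) y =>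
      ‖sceneryLimsup g μ.1 y - sceneryLimsup g μ.1 x‖ₑ) :=
    (h_limsup.sub (h_limsup.comp (measurable_fst.prodMk measurable_const))).enorm
  unfold sceneryOscillation meanOscillation
  simp_rw [setLAverage_eq]
  exact (Measurable.setLIntegral_kernel_prod_right (κ := phaseKernel d) h_enorm h_ball).div
    ((Measure.measurable_coe h_ball).comp measurable_subtype_coe)

theorem sceneryOscillation_le (hC : ∀ p, |g p| ≤ C) (μ : Measure (Fin d → ℝ)) (x : Fin d → ℝ)
    (r : ℝ) : sceneryOscillation g μ x r ≤ ENNReal.ofReal (2 * C) :=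
  meanOscillation_le (abs_sceneryLimsup_le hC μ)

theorem sceneryOscillation_flow (hg : Measurable g) (hC : ∀ p, |g p| ≤ C) (s : ℝ) (μ : Phase d) :
    sceneryOscillation g (flow s μ).1 0 1 = sceneryOscillation g μ.1 0 (Real.exp (-s)) := by
  have h_emb : MeasurableEmbedding fun y : Fin d → ℝ => Real.exp s • y :=
    measurableEmbedding_const_smul₀ (Real.exp_pos s).ne'
  have h_ball := preimage_exp_smul_closedBall (d := d) s 1
  have h_comp : (sceneryLimsup g (flow s μ).1 ∘ fun y => Real.exp s • y) = sceneryLimsup g μ.1 :=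
    funext (sceneryLimsup_flow hg hC s μ)
  rw [mul_one] at h_ball
  have h := meanOscillation_smul_map (μ := μ.1) h_emb (flowFactor_ne_zero s μ)
    (flowFactor_ne_top s μ) (smul_zero _) h_ball (sceneryLimsup g (flow s μ).1)
  rwa [h_comp] at h

theorem sceneryOscillation_translStar {μ : Measure (Fin d → ℝ)} [IsLocallyFiniteMeasure μ]
    {x : Fin d → ℝ} (hx : x ∈ μ.support) (r : ℝ) :
    sceneryOscillation g (translStar x μ) 0 r = sceneryOscillation g μ x r := by
  have h_emb : MeasurableEmbedding fun y : Fin d → ℝ => y - x := measurableEmbedding_subRight x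
  have h_ball : (fun y => y - x) ⁻¹' Metric.closedBall 0 r = Metric.closedBall x r := by
    ext y
    simp [dist_eq_norm]
  have h_comp : (sceneryLimsup g (translStar x μ) ∘ fun y => y - x) = sceneryLimsup g μ := by
    ext y
    rw [Function.comp_apply, sceneryLimsup_translStar hx, add_sub_cancel]
  rw [sceneryOscillation, translStar_eq_smul, meanOscillation_smul_map h_emb translFactor_ne_zero
    (translFactor_ne_top hx) (sub_self x) h_ball, ← translStar_eq_smul, h_comp, sceneryOscillation]

theorem ae_tendsto_sceneryOscillation_translStar (hg : Measurable g) (hC : ∀ p, |g p| ≤ C)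
    (μ : Phase d) :
    ∀ᵐ x ∂μ.1, Tendsto (sceneryOscillation g (translStar x μ.1) 0) (𝓝[>] 0) (𝓝 0) := by
  have h_loc : LocallyIntegrable (sceneryLimsup g μ.1) μ.1 :=
    (locallyIntegrable_const C).mono (measurable_sceneryLimsup hg μ).aestronglyMeasurable
      (.of_forall fun x => (abs_sceneryLimsup_le hC μ.1 x).trans (le_abs_self C))
  filter_upwards [ae_tendsto_meanOscillation h_loc, Measure.support_mem_ae (μ := μ.1)]
    with x hx hx_supp
  exact hx.congr fun r => (sceneryOscillation_translStar hx_supp r).symm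

end Sceneries

/-! ### Consequences of the quasi-Palm property -/

section QuasiPalm

variable {d : ℕ} {P : ProbabilityMeasure (Phase d)}

theorem ae_translStar_of_ae (hP : IsQuasiPalm P) {p : Measure (Fin d → ℝ) → Prop}
    (hp : ∀ᵐ μ ∂(P : Measure (Phase d)), p μ.1) :
    ∀ᵐ μ ∂(P : Measure (Phase d)), ∀ᵐ x ∂μ.1, p (translStar x μ.1) := by
  have h_map : ∀ᵐ μ ∂(P : Measure (Phase d)).map Subtype.val, p μ :=
    (MeasurableEmbedding.subtype_coe (measurableSet_phase d)).ae_map_iff.2 hp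
  have h_ball (n : ℕ) : ∀ᵐ μ ∂(P : Measure (Phase d)),
      ∀ᵐ x ∂μ.1.restrict (Metric.ball 0 (n + 1)), p (translStar x μ.1) := by
    have h_ac := (hP (Metric.ball 0 (n + 1)) Metric.isOpen_ball Metric.isBounded_ball
      (Metric.mem_ball_self n.cast_add_one_pos)).2
    filter_upwards [Measure.ae_ae_of_ae_bind
      (measurable_diffusion Metric.isOpen_ball.measurableSet).aemeasurable (h_ac.ae_le h_map)]
      with μ hμ
    exact ae_of_ae_map (measurable_translStar μ).aemeasurable hμ
  filter_upwards [ae_all_iff.2 h_ball] with μ hμ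
  simpa only [Metric.iUnion_ball_nat_succ, Measure.restrict_univ] using
    (ae_restrict_iUnion_iff _ _).2 hμ

theorem ae_of_ae_translStar (hP : IsQuasiPalm P) {p : Measure (Fin d → ℝ) → Prop}
    (h_meas : MeasurableSet {μ : Phase d | p μ.1})
    (hp : ∀ᵐ μ ∂(P : Measure (Phase d)), ∀ᵐ x ∂μ.1, p (translStar x μ.1)) :
    ∀ᵐ μ ∂(P : Measure (Phase d)), p μ.1 := by
  let N : Set (Measure (Fin d → ℝ)) := Subtype.val '' {μ : Phase d | p μ.1}ᶜ
  have hN : MeasurableSet N :=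
    (MeasurableEmbedding.subtype_coe (measurableSet_phase d)).measurableSet_image.2 h_meas.compl
  have hN_not : ∀ μ ∈ N, ¬p μ := by
    rintro _ ⟨μ, hμ, rfl⟩
    exact hμ
  have h_bind : (P : Measure (Phase d)).bind (fun μ => diffusion (Metric.ball 0 1) μ.1) N = 0 := by
    rw [Measure.bind_apply hN (measurable_diffusion Metric.isOpen_ball.measurableSet).aemeasurable]
    refine lintegral_eq_zero_of_ae_eq_zero ?_
    filter_upwards [hp] with μ hμ
    rw [diffusion, Measure.map_apply (measurable_translStar μ) hN]
    exact measure_mono_null (fun x hx => hN_not _ hx) (ae_iff.1 (ae_restrict_of_ae hμ))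
  have h_map := (hP (Metric.ball 0 1) Metric.isOpen_ball Metric.isBounded_ball
    (Metric.mem_ball_self one_pos)).1 h_bind
  rwa [Measure.map_apply measurable_subtype_coe hN,
    preimage_image_eq _ Subtype.val_injective] at h_map

variable {g : ProbabilityMeasure (unitBall d) → ℝ} {C : ℝ}

theorem ae_tendsto_sceneryOscillation_flow (hP : IsQuasiPalm P) (hg : Measurable g)
    (hC : ∀ p, |g p| ≤ C) :
    ∀ᵐ μ ∂(P : Measure (Phase d)),
      Tendsto (fun n : ℕ => sceneryOscillation g (flow n μ).1 0 1) atTop (𝓝 0) := by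
  have h_radius : Tendsto (fun n : ℕ => Real.exp (-n)) atTop (𝓝[>] 0) :=
    tendsto_nhdsWithin_iff.2 ⟨Real.tendsto_exp_neg_atTop_nhds_zero.comp
      tendsto_natCast_atTop_atTop, .of_forall fun n => Real.exp_pos _⟩
  simp_rw [sceneryOscillation_flow hg hC]
  refine ae_of_ae_translStar hP (p := fun μ =>
    Tendsto (fun n : ℕ => sceneryOscillation g μ 0 (Real.exp (-n))) atTop (𝓝 0))
    (measurableSet_tendsto _ fun n => measurable_sceneryOscillation hg 0 _) (.of_forall fun μ => ?_)
  filter_upwards [ae_tendsto_sceneryOscillation_translStar hg hC μ] with x hx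
  exact hx.comp h_radius

theorem ae_sceneryOscillation_eq_zero (hP : IsFractalDistribution P) (hg : Measurable g)
    (hC : ∀ p, |g p| ≤ C) :
    ∀ᵐ μ ∂(P : Measure (Phase d)), sceneryOscillation g μ.1 0 1 = 0 := by
  have h_meas := measurable_sceneryOscillation (d := d) hg 0 1
  have h_lim := tendsto_lintegral_of_dominated_convergence (fun _ => ENNReal.ofReal (2 * C))
    (fun n : ℕ => h_meas.comp (isMeasurableFlow_flow.measurable n))
    (fun n => .of_forall fun μ => sceneryOscillation_le hC (flow n μ).1 0 1)
    (by rw [lintegral_const]; finiteness) (ae_tendsto_sceneryOscillation_flow hP.2 hg hC)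
  have h_const (n : ℕ) : ∫⁻ μ, sceneryOscillation g (flow n μ).1 0 1 ∂(P : Measure (Phase d)) =
      ∫⁻ μ, sceneryOscillation g μ.1 0 1 ∂(P : Measure (Phase d)) :=
    (hP.1 n).lintegral_comp h_meas
  have h_zero := tendsto_nhds_unique (h_lim.congr h_const) tendsto_const_nhds
  rw [lintegral_zero] at h_zero
  exact (lintegral_eq_zero_iff h_meas).1 h_zero.symm

theorem ae_sceneryLimsup_eq (hP : IsFractalDistribution P) (hg : Measurable g)
    (hC : ∀ p, |g p| ≤ C) :
    ∀ᵐ μ ∂(P : Measure (Phase d)), ∀ᵐ x ∂μ.1, sceneryLimsup g μ.1 x = sceneryLimsup g μ.1 0 := by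
  have h_flow (n : ℕ) : ∀ᵐ μ ∂(P : Measure (Phase d)),
      sceneryOscillation g (flow (-n) μ).1 0 1 = 0 :=
    (hP.1 (-n)).quasiMeasurePreserving.ae (ae_sceneryOscillation_eq_zero hP hg hC)
  filter_upwards [ae_all_iff.2 h_flow] with μ hμ
  simp_rw [sceneryOscillation_flow hg hC, neg_neg] at hμ
  have h_ball (n : ℕ) : ∀ᵐ x ∂μ.1.restrict (expBall d n),
      sceneryLimsup g μ.1 x = sceneryLimsup g μ.1 0 :=
    ae_restrict_eq_of_meanOscillation_eq_zero (measurable_sceneryLimsup hg μ).aemeasurable (hμ n)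
  simpa only [iUnion_expBall, Measure.restrict_univ] using (ae_restrict_iUnion_iff _ _).2 h_ball

end QuasiPalm

/-! ### Generated distributions -/

section WeakConvergence

variable {K : Type*} [TopologicalSpace K] [CompactSpace K] [MeasurableSpace K]
  [OpensMeasurableSpace K]

theorem lipschitzWith_integral (Q : Measure K) [IsProbabilityMeasure Q] :
    LipschitzWith 1 fun f : C(K, ℝ) => ∫ p, f p ∂Q := by
  have h_int (f : C(K, ℝ)) : Integrable f Q :=
    .of_bound f.continuous.measurable.aestronglyMeasurable ‖f‖ (.of_forall f.norm_coe_le_norm)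
  refine LipschitzWith.of_dist_le_mul fun f g => ?_
  rw [dist_eq_norm, ← integral_sub (h_int f) (h_int g), NNReal.coe_one, one_mul, dist_eq_norm]
  simpa using norm_integral_le_of_norm_le_const (μ := Q) (f := fun p => f p - g p)
    (.of_forall fun p => (f - g).norm_coe_le_norm p)

theorem tendsto_probabilityMeasure_of_dense {ι : Type*} {l : Filter ι}
    {R : ι → ProbabilityMeasure K} {Q : ProbabilityMeasure K} {D : Set C(K, ℝ)} (hD : Dense D)
    (h : ∀ f ∈ D,
      Tendsto (fun i => ∫ p, f p ∂(R i : Measure K)) l (𝓝 (∫ p, f p ∂(Q : Measure K)))) :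
    Tendsto R l (𝓝 Q) := by
  have h_equicontinuous : Equicontinuous fun i (f : C(K, ℝ)) => ∫ p, f p ∂(R i : Measure K) :=
    (LipschitzWith.uniformEquicontinuous _ 1 fun i => lipschitzWith_integral _).equicontinuous
  have h_closed := h_equicontinuous.isClosed_setOfPred_tendsto (l := l)
    (lipschitzWith_integral (Q : Measure K)).continuous
  refine ProbabilityMeasure.tendsto_iff_forall_integral_tendsto.2 fun f => ?_
  exact h_closed.closure_subset_iff.2 h (hD f.toContinuousMap)

end WeakConvergence

section Generation

variable {d : ℕ}

theorem integral_sceneryDist (μ : Measure (Fin d → ℝ)) [IsLocallyFiniteMeasure μ] (x : Fin d → ℝ)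
    {T : ℝ} (hT : 0 < T) {g : ProbabilityMeasure (unitBall d) → ℝ} (hg : Measurable g) :
    ∫ p, g p ∂(sceneryDist μ x T : Measure (ProbabilityMeasure (unitBall d))) =
      cesaro (fun t => g (scenery μ x t)) T := by
  change ∫ p, g p ∂sceneryMeasure μ x T = _
  rw [sceneryMeasure, if_pos hT, integral_smul_measure,
    integral_map (measurable_scenery μ x).aemeasurable hg.aestronglyMeasurable, cesaro_eq_inv_mul,
    intervalIntegral.integral_of_le hT.le, integral_Icc_eq_integral_Ioc, ENNReal.toReal_inv,
    ENNReal.toReal_ofReal hT.le, smul_eq_mul]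

theorem generatesAt_of_dense {μ : Measure (Fin d → ℝ)} [IsLocallyFiniteMeasure μ] {x : Fin d → ℝ}
    (hx : x ∈ μ.support) {Q : ProbabilityMeasure (ProbabilityMeasure (unitBall d))}
    {D : Set C(ProbabilityMeasure (unitBall d), ℝ)} (hD : Dense D)
    (h : ∀ g ∈ D, Tendsto (fun n : ℕ => cesaro (fun t => g (scenery μ x t)) n) atTop
      (𝓝 (∫ p, g p ∂(Q : Measure (ProbabilityMeasure (unitBall d)))))) : GeneratesAt μ x Q := by
  refine ⟨hx, tendsto_probabilityMeasure_of_dense hD fun g hg => ?_⟩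
  have hg_meas := g.continuous.measurable
  refine (tendsto_cesaro_of_tendsto_nat (hg_meas.comp (measurable_scenery μ x))
    (fun t => g.norm_coe_le_norm _) (h g hg)).congr' ?_
  filter_upwards [eventually_gt_atTop 0] with T hT
  exact (integral_sceneryDist μ x hT hg_meas).symm

theorem integral_restricted (Q : ProbabilityMeasure (Phase d))
    {g : ProbabilityMeasure (unitBall d) → ℝ} (hg : Measurable g) :
    ∫ p, g p ∂(restricted Q : Measure (ProbabilityMeasure (unitBall d))) =
      ∫ ν : Phase d, g (box ν.1) ∂(Q : Measure (Phase d)) :=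
  integral_map ((measurable_box d).comp measurable_subtype_coe).aemeasurable
    hg.aestronglyMeasurable

variable {P : ProbabilityMeasure (Phase d)} {κ : Phase d → ProbabilityMeasure (Phase d)}

theorem IsErgodicDecomposition.ae_eq_condExpKernel (hκ : IsErgodicDecomposition P κ) :
    ∀ᵐ μ ∂(P : Measure (Phase d)),
      (κ μ : Measure (Phase d)) = condExpKernel (P : Measure (Phase d)) (invariantSets d) μ := by
  have h_meas : Measurable[invariantSets d] fun μ => (κ μ : Measure (Phase d)) :=
    @Measurable.comp _ _ _ (invariantSets d) _ _ _ _ measurable_subtype_coe hκ.measurable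
  let κ' : Kernel[invariantSets d] (Phase d) (Phase d) :=
    @Kernel.mk _ _ (invariantSets d) _ (fun μ => κ μ) h_meas
  have : IsMarkovKernel κ' := ⟨fun μ => (κ μ).2⟩
  have hm := flowInvariants_le (flow (d := d))
  refine ae_eq_condExpKernel_of_carried (κ := κ') hm (fun B hB => ?_) hκ.ae_carried
  exact (Measure.bind_apply hB (h_meas.mono hm le_rfl).aemeasurable).symm.trans
    (congrArg (· B) hκ.barycenter)

theorem ae_tendsto_cesaro_scenery_zero (hP : IsScaleInvariant P) (hκ : IsErgodicDecomposition P κ)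
    (g : C(ProbabilityMeasure (unitBall d), ℝ)) :
    ∀ᵐ μ ∂(P : Measure (Phase d)),
      Tendsto (fun n : ℕ => cesaro (fun t => g (scenery μ.1 0 t)) n) atTop
        (𝓝 (∫ p, g p ∂(restricted (κ μ) : Measure (ProbabilityMeasure (unitBall d))))) := by
  have hg := g.continuous.measurable
  simp_rw [scenery_zero, integral_restricted _ hg]
  filter_upwards [hκ.ae_eq_condExpKernel,
    isMeasurableFlow_flow.ae_tendsto_cesaro_integral_condExpKernel hP
      (hg.comp ((measurable_box d).comp measurable_subtype_coe)) fun μ => g.norm_coe_le_norm _]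
    with μ h_eq h_tendsto
  rwa [h_eq]

theorem ae_tendsto_cesaro_scenery (hP : IsFractalDistribution P)
    (hκ : IsErgodicDecomposition P κ) (g : C(ProbabilityMeasure (unitBall d), ℝ)) :
    ∀ᵐ μ ∂(P : Measure (Phase d)), ∀ᵐ x ∂μ.1,
      Tendsto (fun n : ℕ => cesaro (fun t => g (scenery μ.1 x t)) n) atTop
        (𝓝 (∫ p, g p ∂(restricted (κ μ) : Measure (ProbabilityMeasure (unitBall d))))) := by
  have h_zero := ae_tendsto_cesaro_scenery_zero hP.1 hκ g
  have h_limsup : ∀ᵐ μ ∂(P : Measure (Phase d)),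
      Tendsto (fun n : ℕ => cesaro (fun t => g (scenery μ.1 0 t)) n) atTop
        (𝓝 (sceneryLimsup g μ.1 0)) := by
    filter_upwards [h_zero] with μ hμ
    rwa [sceneryLimsup, cesaroLimsup, hμ.limsup_eq]
  filter_upwards [h_zero, ae_translStar_of_ae hP.2
      (p := fun ν => Tendsto (fun n : ℕ => cesaro (fun t => g (scenery ν 0 t)) n) atTop
        (𝓝 (sceneryLimsup g ν 0))) h_limsup,
    ae_sceneryLimsup_eq hP g.continuous.measurable g.norm_coe_le_norm]
    with μ h_zero h_transl h_const
  filter_upwards [h_transl, h_const, Measure.support_mem_ae (μ := μ.1)] with x hx h_eq hx_supp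
  simp_rw [sceneryLimsup_translStar hx_supp, scenery_translStar hx_supp, add_zero, h_eq] at hx
  rwa [sceneryLimsup, cesaroLimsup, h_zero.limsup_eq] at hx

theorem ae_isUSMGenerating (hP : IsFractalDistribution P) (hκ : IsErgodicDecomposition P κ) :
    ∀ᵐ μ ∂(P : Measure (Phase d)), IsUSMGenerating μ.1 (restricted (κ μ)) := by
  obtain ⟨D, h_countable, h_dense⟩ :=
    TopologicalSpace.exists_countable_dense C(ProbabilityMeasure (unitBall d), ℝ)
  filter_upwards [(ae_ball_iff h_countable).2 fun g _ => ae_tendsto_cesaro_scenery hP hκ g]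
    with μ hμ
  filter_upwards [(ae_ball_iff h_countable).2 hμ, Measure.support_mem_ae (μ := μ.1)]
    with x hx hx_supp
  exact generatesAt_of_dense hx_supp h_dense hx

theorem exists_isErgodicDecomposition (hP : IsScaleInvariant P) :
    ∃ κ, IsErgodicDecomposition P κ := by
  have hm := flowInvariants_le (flow (d := d))
  refine ⟨fun μ => ⟨condExpKernel (P : Measure (Phase d)) (invariantSets d) μ, inferInstance⟩,
    ?_, ?_, ?_, ?_, fun A hA => ae_condExpKernel_apply_eq_one hm hA⟩
  · exact Measurable.subtype_mk (Kernel.measurable _)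
  · refine Measure.ext fun B hB => ?_
    refine (Measure.bind_apply hB ((Kernel.measurable _).mono hm le_rfl).aemeasurable).trans ?_
    simpa using setLIntegral_condExpKernel_apply (P := (P : Measure (Phase d))) hm .univ hB
  · exact isMeasurableFlow_flow.ae_condExpKernel_invariant hP
  · exact isMeasurableFlow_flow.ae_condExpKernel_ergodic hP

theorem isErgodicDecomposition_const (hP : IsScaleInvariant P) (hE : IsErgodicDist P) :
    IsErgodicDecomposition P fun _ => P where
  measurable := @measurable_const _ _ _ (invariantSets d) _
  barycenter := by simp
  ae_invariant := .of_forall fun _ => hP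
  ae_ergodic := .of_forall fun _ => hE
  ae_carried A hA := by
    obtain ⟨hA_meas, hA_inv⟩ := measurableSet_flowInvariants.1 hA
    obtain h | h := hE A hA_meas fun t => by simp [hA_inv t]
    · filter_upwards [measure_eq_zero_iff_ae_notMem.1 h] with μ hμ hμA
      exact absurd hμA hμ
    · exact .of_forall fun _ _ => h

end Generation

end

end FractalDist

theorem mainTheorem4 (d : ℕ) (P : ProbabilityMeasure (FractalDist.Phase d))
    (hP : FractalDist.IsFractalDistribution P) :
    (∃ κ : FractalDist.Phase d → ProbabilityMeasure (FractalDist.Phase d),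
      FractalDist.IsErgodicDecomposition P κ) ∧
    (∀ κ : FractalDist.Phase d → ProbabilityMeasure (FractalDist.Phase d),
      FractalDist.IsErgodicDecomposition P κ →
        ∀ᵐ μ ∂(P : Measure (FractalDist.Phase d)),
          FractalDist.IsUSMGenerating μ.1 (FractalDist.restricted (κ μ))) ∧
    (FractalDist.IsErgodicDist P →
      ∀ᵐ μ ∂(P : Measure (FractalDist.Phase d)),
        FractalDist.IsUSMGenerating μ.1 (FractalDist.restricted P)) :=
  ⟨FractalDist.exists_isErgodicDecomposition hP.1,
    fun _ hκ => FractalDist.ae_isUSMGenerating hP hκ,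
    fun hE => FractalDist.ae_isUSMGenerating hP
      (FractalDist.isErgodicDecomposition_const hP.1 hE)⟩
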